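/- Let $d\ge 1$, let $1<p<\infty$ if $d\in\{1,2\}$ and $1<p<\frac{d+2}{d-2}$ if $d\ge 3$. Let $V:\mathbb R^d\to[0,\infty)$ be measurable with $V(\mathbf x)\to\infty$ as $|\mathbf x|\to\infty$. Let $L_z=i(x_2\partial_{x_1}-x_1\partial_{x_2})$ if $d\ge2$ and $L_z=0$ if $d=1$. Let $\Omega\in\mathbb R$ satisfy $\Omega=0$ or $0<|\Omega|<\Omega_{\max}$, where $$\Omega_{\max}=\sup\Big\{\gamma>0:\ \lim_{|\mathbf x|\to\infty}\Big(V(\mathbf x)-\tfrac{\gamma^2}{2}(x_1^2+x_2^2)\Big)=\infty\Big\}\le\infty$$ (for $d=1$ the term $x_1^2+x_2^2$ is read as $0$, so that $\Omega$ is arbitrary). Let $X=\{\phi\in H^1(\mathbb R^d;\mathbb C):\int V|\phi|^2<\infty\}$ with norm $\|\phi\|_X^2=\int|\nabla\phi|^2+(1+V)|\phi|^2$. Let $R=-\frac12\Delta+V-\Omega L_z$ be the operator on $L^2(\mathbb R^d)$ associated with the form $\langle R u,v\rangle=\int\big(\frac12\nabla u\cdot\nabla\bar v+Vu\bar v-\Omega\,\bar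 v L_zu\big)$ on $X$, let $$\lambda_0(\Omega)=\inf_{0\ne\phi\in X}\frac{\langle R\phi,\phi\rangle}{\|\phi\|_{L^2}^2}$$ be its lowest eigenvalue, and let $E_0=\{\phi: R\phi=\lambda_0(\Omega)\phi\}$ be the corresponding eigenspace. For $\omega\in\mathbb R$ and $\phi\in X$ let $$S_{\Omega,\omega}(\phi)=\langle R\phi,\phi\rangle+\frac{2}{p+1}\|\phi\|_{L^{p+1}}^{p+1}+\omega\|\phi\|_{L^2}^2 .$$ An action ground state for $(\Omega,\omega)$ is a $\phi\in X$ which minimizes $S_{\Omega,\omega}$ among all nonzero weak solutions in $X$ of $-\frac12\Delta\phi+V\phi+|\phi|^{p-1}\phi-\Omega L_z\phi+\omega\phi=0$ or, in the other customary description, which minimizes $S_{\Omega,\omega}$ over all of $X$. Then, with either description of action ground states, the $L^2$-normalised action ground states $\hat\phi_{\Omega,\omega}=\phi_{\Omega,\omega}/\|\phi_{\Omega,\omega}\|_{L^2}$ satisfy $$\lim_{\omega\to-\lambda_0(\Omega)^-} d(\hat\phi_{\Omega,\omega},E_0)=0,\qquad d(\hat\phi_{\Omega,\omega},E_0)=\inf_{\phi\in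 E_0}\|\hat\phi_{\Omega,\omega}-\phi\|_X ,$$ where $\phi_{\Omega,\omega}$ is an arbitrary action ground state for $(\Omega,\omega)$; that is, for every $\varepsilon>0$ there is $\delta>0$ such that $d(\hat\phi_{\Omega,\omega},E_0)<\varepsilon$ for all $\omega\in(-\lambda_0(\Omega)-\delta,-\lambda_0(\Omega))$ and all action ground states $\phi_{\Omega,\omega}$. -/

import Mathlib

open MeasureTheory Filter Topology
open scoped ComplexConjugate

noncomputable section

namespace RotNLS

/-- The space `ℝ^d` with its Euclidean norm and Lebesgue measure. -/
abbrev Rd (d : ℕ) : Type := EuclideanSpace ℝ (Fin d)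

/-! ### Weak derivatives and the energy space -/

/-- `g` is the weak partial derivative `∂ᵢ u`:
`∫ (∂ᵢ η) u = - ∫ η g` for all (real) test functions `η ∈ C_c^∞(ℝ^d)`. -/
def HasWeakPartial {d : ℕ} (i : Fin d) (u g : Rd d → ℂ) : Prop :=
  LocallyIntegrable u ∧ LocallyIntegrable g ∧
    ∀ η : Rd d → ℝ, ContDiff ℝ (⊤ : ℕ∞) η → HasCompactSupport η →
      ∫ x, (fderiv ℝ η x (EuclideanSpace.single i (1 : ℝ))) • u x = -∫ x, η x • g x

open Classical in
/-- A representative of the weak partial derivative `∂ᵢ u` (which is unique almost everywhere);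
the zero function if there is none. -/
def weakPartial {d : ℕ} (i : Fin d) (u : Rd d → ℂ) : Rd d → ℂ :=
  if h : ∃ g, HasWeakPartial i u g then h.choose else 0

/-- Membership in `H^1(ℝ^d)`: `u` and its weak partial derivatives are in `L^2`. -/
def MemH1 {d : ℕ} (u : Rd d → ℂ) : Prop :=
  MemLp u 2 ∧ ∀ i : Fin d, ∃ g : Rd d → ℂ, HasWeakPartial i u g ∧ MemLp g 2

/-- The energy space `X = H^1(ℝ^d) ∩ L^2_V(ℝ^d)`, as a set of functions. -/
def X {d : ℕ} (V : Rd d → ℝ) : Set (Rd d → ℂ) :=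
  {u | MemH1 u ∧ Integrable (fun x => V x * ‖u x‖ ^ 2)}

/-- `‖u‖_{L^2}`. -/
def normL2 {d : ℕ} (u : Rd d → ℂ) : ℝ := √(∫ x, ‖u x‖ ^ 2)

/-- `‖u‖_X = (∫ |∇u|² + (1 + V) |u|²)^{1/2}`. -/
def normX {d : ℕ} (V : Rd d → ℝ) (u : Rd d → ℂ) : ℝ :=
  √(∫ x, ((∑ i : Fin d, ‖weakPartial i u x‖ ^ 2) + (1 + V x) * ‖u x‖ ^ 2))

/-! ### Rotation -/

/-- `x₁² + x₂²`, the squared distance to the axis of rotation. In dimension `d = 1`, where there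
is no rotation, it is set to `0`, so that then no condition on the rotation speed arises. -/
def axisDistSq {d : ℕ} (x : Rd d) : ℝ :=
  if h : 2 ≤ d then x ⟨0, by omega⟩ ^ 2 + x ⟨1, by omega⟩ ^ 2 else 0

/-- The angular momentum `L_z u = i (x₂ ∂₁ u - x₁ ∂₂ u)` for `d ≥ 2`, and `L_z u = 0` for
`d = 1`. -/
def angMom {d : ℕ} (u : Rd d → ℂ) : Rd d → ℂ :=
  if h : 2 ≤ d then fun x =>
    Complex.I * ((x ⟨1, by omega⟩ : ℂ) * weakPartial ⟨0, by omega⟩ u x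
      - (x ⟨0, by omega⟩ : ℂ) * weakPartial ⟨1, by omega⟩ u x)
  else 0

/-- The critical rotation speed
`Ω_max = sup {γ > 0 : V(x) - (γ²/2)(x₁² + x₂²) → ∞ as |x| → ∞}`, possibly infinite
(and `⊥` if there is no such `γ`). -/
def OmegaMax {d : ℕ} (V : Rd d → ℝ) : EReal :=
  sSup ((fun γ : ℝ => (γ : EReal)) '' {γ : ℝ | 0 < γ ∧
    Tendsto (fun x : Rd d => V x - γ ^ 2 / 2 * axisDistSq x) (cocompact (Rd d)) atTop})

/-- The rotational energy `L_Ω(u) = - Ω ∫ ū L_z u` (a real number for `u ∈ X`). -/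
def rotEnergy {d : ℕ} (Ω : ℝ) (u : Rd d → ℂ) : ℝ :=
  (-(Ω : ℂ) * ∫ x, conj (u x) * angMom u x).re

/-! ### The linear operator `R = -½ Δ + V - Ω L_z` -/

/-- The quadratic form `∫ (½ |∇u|² + V |u|² - Ω ū L_z u)` of `R`. -/
def quadR {d : ℕ} (V : Rd d → ℝ) (Ω : ℝ) (u : Rd d → ℂ) : ℝ :=
  1 / 2 * (∫ x, ∑ i : Fin d, ‖weakPartial i u x‖ ^ 2) + (∫ x, V x * ‖u x‖ ^ 2) + rotEnergy Ω u

/-- The sesquilinear form `⟨R u, v⟩ = ∫ (½ ∇u · ∇v̄ + V u v̄ - Ω v̄ L_z u)` of `R`. -/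
def formR {d : ℕ} (V : Rd d → ℝ) (Ω : ℝ) (u v : Rd d → ℂ) : ℂ :=
  1 / 2 * (∫ x, ∑ i : Fin d, weakPartial i u x * conj (weakPartial i v x))
    + (∫ x, (V x : ℂ) * u x * conj (v x)) - (Ω : ℂ) * ∫ x, conj (v x) * angMom u x

/-- `u` is in the domain of the operator `R` on `L^2` associated with its form on `X`, and
`R u = f`. -/
def OperatorR {d : ℕ} (V : Rd d → ℝ) (Ω : ℝ) (u f : Rd d → ℂ) : Prop :=
  u ∈ X V ∧ MemLp f 2 ∧ ∀ v ∈ X V, formR V Ω u v = ∫ x, f x * conj (v x)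

/-- `λ₀(Ω)`, the infimum of the Rayleigh quotient of `R` over `X \ {0}`. -/
def lambda0 {d : ℕ} (V : Rd d → ℝ) (Ω : ℝ) : ℝ :=
  sInf {r : ℝ | ∃ u ∈ X V, ¬ u =ᵐ[volume] 0 ∧ r = quadR V Ω u / normL2 u ^ 2}

/-- `E₀ = {u : R u = λ₀(Ω) u}`, the eigenspace of `R` at `λ₀(Ω)`. -/
def E0 {d : ℕ} (V : Rd d → ℝ) (Ω : ℝ) : Set (Rd d → ℂ) :=
  {u | OperatorR V Ω u (fun x => (lambda0 V Ω : ℂ) * u x)}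

/-- `d(u, E₀) = inf_{φ ∈ E₀} ‖u - φ‖_X`. -/
def distE0 {d : ℕ} (V : Rd d → ℝ) (Ω : ℝ) (u : Rd d → ℂ) : ℝ :=
  sInf ((fun φ => normX V (u - φ)) '' E0 V Ω)

/-! ### Action ground states -/

/-- The action
`S_{Ω,ω}(u) = ½ ‖∇u‖² + ∫ V |u|² + 2/(p+1) ‖u‖_{L^{p+1}}^{p+1} + L_Ω(u) + ω ‖u‖²`. -/
def action {d : ℕ} (p : ℝ) (V : Rd d → ℝ) (Ω ω : ℝ) (u : Rd d → ℂ) : ℝ :=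
  1 / 2 * (∫ x, ∑ i : Fin d, ‖weakPartial i u x‖ ^ 2) + (∫ x, V x * ‖u x‖ ^ 2)
    + 2 / (p + 1) * (∫ x, ‖u x‖ ^ (p + 1)) + rotEnergy Ω u + ω * ∫ x, ‖u x‖ ^ 2

/-- `u ∈ X` is a nontrivial (weak) solution of the stationary equation
`-½ Δu + V u + |u|^{p-1} u - Ω L_z u + ω u = 0`. -/
def IsStationary {d : ℕ} (p : ℝ) (V : Rd d → ℝ) (Ω ω : ℝ) (u : Rd d → ℂ) : Prop :=
  u ∈ X V ∧ ¬ u =ᵐ[volume] 0 ∧ ∀ v ∈ X V,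
    formR V Ω u v + (∫ x, ((‖u x‖ ^ (p - 1) : ℝ) : ℂ) * u x * conj (v x))
      + (ω : ℂ) * (∫ x, u x * conj (v x)) = 0

/-- The action ground states `𝒜_{Ω,ω}`: the nontrivial stationary states of least action. -/
def actionGroundStates {d : ℕ} (p : ℝ) (V : Rd d → ℝ) (Ω ω : ℝ) : Set (Rd d → ℂ) :=
  {u | IsStationary p V Ω ω u ∧
    ∀ v, IsStationary p V Ω ω v → action p V Ω ω u ≤ action p V Ω ω v}

/-- The minimizers of the action over the whole space `X`, the second description of the action
ground states. -/
def actionMinimizers {d : ℕ} (p : ℝ) (V : Rd d → ℝ) (Ω ω : ℝ) : Set (Rd d → ℂ) :=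
  {u | u ∈ X V ∧ ∀ v ∈ X V, action p V Ω ω u ≤ action p V Ω ω v}

/-- The normalized function `u / ‖u‖_{L^2}`. -/
def normalize {d : ℕ} (u : Rd d → ℂ) : Rd d → ℂ :=
  fun x => u x / (normL2 u : ℂ)

end RotNLS

end

/-!
Every action ground state `φ`, in either description, satisfies `⟨Rφ, φ⟩ + ω ‖φ‖² ≤ 0`: for a
stationary state this is the stationary equation tested with `φ`
(`IsStationary.quadR_add_le`), for a minimizer of the action it is the comparison with the zero
function (`quadR_add_le_of_mem_actionMinimizers`); in both cases the nonlinear term has a sign and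
is dropped. Hence the Rayleigh quotient of the normalized state lies between `λ₀(Ω)` and `-ω`, and
as `ω → -λ₀(Ω)` from below the normalized states are near-minimizers of the Rayleigh quotient.

It remains to see that near-minimizers are close to the eigenspace `E₀` in the energy norm
(`exists_distE0_lt_of_near_minimizer`). A sequence of normalized near-minimizers is bounded in `X`
by Gårding's inequality (`SubcriticalRotation.coercive`), where the condition on the rotation speed
enters, and has an `L²`-Cauchy subsequence by Rellich's theorem (`exists_cauchy_subseq_normL2`),
where the confinement enters. The form `Q` of `R - λ₀(Ω)` is nonnegative, so that the parallelogram
law gives `Q(uₙ - uₘ) ≤ 2 Q(uₙ) + 2 Q(uₘ) → 0`; with Gårding's inequality the subsequence is Cauchy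
in `X`. By completeness (`exists_tendsto_normX`) it converges to some `v` with `Q(v) = 0`, and a
zero of the nonnegative Hermitian form `Q` lies in `E₀` (`mem_E0_of_shiftedQuad_eq_zero`).

Two facts on weak derivatives carry the analysis; both come from differentiating the pairing of `u`
with a translated test function (`HasWeakDir.hasDerivAt_integral_translate`). The translation
estimate `‖u(· + h) - u‖ ≤ ‖∂ₕ u‖` in `L²` yields Friedrichs' inequality (`friedrichs`) and through
it compactness. The weak convergence of difference quotients yields integration by parts for two
functions of `H¹`, hence, with radial cutoffs, the symmetry of the angular momentum and of the form
of `R`.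
-/

noncomputable section

namespace RotNLS

variable {d : ℕ}

/-! ### Weak directional derivatives -/

/-- `g` is the weak derivative of `u` in the direction `h`. For a standard basis vector this is
`HasWeakPartial`, definitionally; the predicate is linear in `h`. -/
def HasWeakDir (h : Rd d) (u g : Rd d → ℂ) : Prop :=
  LocallyIntegrable u ∧ LocallyIntegrable g ∧
    ∀ η : Rd d → ℝ, ContDiff ℝ (⊤ : ℕ∞) η → HasCompactSupport η →
      ∫ x, (fderiv ℝ η x h) • u x = -∫ x, η x • g x

theorem continuous_fderiv_apply {F : Type*} [NormedAddCommGroup F] [NormedSpace ℝ F]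
    {η : Rd d → F} (hη : ContDiff ℝ (⊤ : ℕ∞) η) (h : Rd d) :
    Continuous fun x => fderiv ℝ η x h :=
  (hη.continuous_fderiv (by simp)).clm_apply continuous_const

theorem hasCompactSupport_fderiv_apply {F : Type*} [NormedAddCommGroup F] [NormedSpace ℝ F]
    {η : Rd d → F} (hη : HasCompactSupport η) (h : Rd d) :
    HasCompactSupport fun x => fderiv ℝ η x h :=
  hη.fderiv_apply ℝ h

namespace HasWeakDir

variable {h k : Rd d} {u v f g : Rd d → ℂ}

theorem unique (hf : HasWeakDir h u f) (hg : HasWeakDir h u g) : f =ᵐ[volume] g :=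
  ae_eq_of_integral_contDiff_smul_eq hf.2.1 hg.2.1 fun η h1 h2 => by
    have := hf.2.2 η h1 h2
    rw [hg.2.2 η h1 h2] at this
    exact (neg_injective this).symm

theorem congr_ae (hf : HasWeakDir h u f) (huv : u =ᵐ[volume] v) (hfg : f =ᵐ[volume] g) :
    HasWeakDir h v g := by
  refine ⟨hf.1.congr huv, hf.2.1.congr hfg, fun η h1 h2 => ?_⟩
  have e1 : ∫ x, (fderiv ℝ η x h) • v x = ∫ x, (fderiv ℝ η x h) • u x :=
    integral_congr_ae (huv.mono fun x hx => by simp only [hx])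
  have e2 : ∫ x, η x • g x = ∫ x, η x • f x :=
    integral_congr_ae (hfg.mono fun x hx => by simp only [hx])
  rw [e1, e2, hf.2.2 η h1 h2]

theorem add (hu : HasWeakDir h u f) (hv : HasWeakDir h v g) :
    HasWeakDir h (u + v) (f + g) := by
  refine ⟨hu.1.add hv.1, hu.2.1.add hv.2.1, fun η h1 h2 => ?_⟩
  simp only [Pi.add_apply, smul_add]
  have c := continuous_fderiv_apply h1 h
  have s := hasCompactSupport_fderiv_apply h2 h
  rw [integral_add (hu.1.integrable_smul_left_of_hasCompactSupport c s)
      (hv.1.integrable_smul_left_of_hasCompactSupport c s),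
    integral_add (hu.2.1.integrable_smul_left_of_hasCompactSupport h1.continuous h2)
      (hv.2.1.integrable_smul_left_of_hasCompactSupport h1.continuous h2),
    hu.2.2 η h1 h2, hv.2.2 η h1 h2, neg_add]

theorem const_smul (hu : HasWeakDir h u f) (c : ℂ) : HasWeakDir h (c • u) (c • f) := by
  refine ⟨hu.1.smul c, hu.2.1.smul c, fun η h1 h2 => ?_⟩
  simp only [Pi.smul_apply, smul_comm _ c]
  rw [integral_smul, integral_smul, hu.2.2 η h1 h2, smul_neg]

theorem add_dir (hu : HasWeakDir h u f) (hv : HasWeakDir k u g) :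
    HasWeakDir (h + k) u (f + g) := by
  refine ⟨hu.1, hu.2.1.add hv.2.1, fun η h1 h2 => ?_⟩
  simp only [Pi.add_apply, smul_add, map_add, add_smul]
  rw [integral_add (hu.1.integrable_smul_left_of_hasCompactSupport (continuous_fderiv_apply h1 h)
        (hasCompactSupport_fderiv_apply h2 h))
      (hu.1.integrable_smul_left_of_hasCompactSupport (continuous_fderiv_apply h1 k)
        (hasCompactSupport_fderiv_apply h2 k)),
    integral_add (hu.2.1.integrable_smul_left_of_hasCompactSupport h1.continuous h2)
      (hv.2.1.integrable_smul_left_of_hasCompactSupport h1.continuous h2),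
    hu.2.2 η h1 h2, hv.2.2 η h1 h2, neg_add]

theorem smul_dir (hu : HasWeakDir h u f) (c : ℝ) : HasWeakDir (c • h) u ((c : ℂ) • f) := by
  refine ⟨hu.1, hu.2.1.smul (c : ℂ), fun η h1 h2 => ?_⟩
  have e1 : ∀ x, (fderiv ℝ η x (c • h)) • u x = c • ((fderiv ℝ η x h) • u x) := fun x => by
    rw [map_smul, smul_assoc]
  have e2 : ∀ x, η x • ((c : ℂ) • f) x = c • (η x • f x) := fun x => by
    rw [Pi.smul_apply, Complex.coe_smul, smul_comm]
  simp only [e1, e2]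
  rw [integral_smul, integral_smul, hu.2.2 η h1 h2, smul_neg]

theorem zero_dir (hu : LocallyIntegrable u) : HasWeakDir (0 : Rd d) u 0 :=
  ⟨hu, locallyIntegrable_zero, fun η _ _ => by simp⟩

theorem sum_dir {ι : Type*} (s : Finset ι) {h : ι → Rd d} {f : ι → Rd d → ℂ}
    (hu : LocallyIntegrable u) (H : ∀ i ∈ s, HasWeakDir (h i) u (f i)) :
    HasWeakDir (∑ i ∈ s, h i) u (∑ i ∈ s, f i) := by
  classical
  induction s using Finset.induction_on with
  | empty => simpa using zero_dir hu
  | insert a s ha ih =>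
    rw [Finset.sum_insert ha, Finset.sum_insert ha]
    exact (H a (Finset.mem_insert_self a s)).add_dir
      (ih fun i hi => H i (Finset.mem_insert_of_mem hi))

/-- Weak derivatives may be tested against complex-valued test functions. -/
theorem integral_fderiv_mul (hu : HasWeakDir h u g) {ζ : Rd d → ℂ}
    (h1 : ContDiff ℝ (⊤ : ℕ∞) ζ) (h2 : HasCompactSupport ζ) :
    ∫ x, fderiv ℝ ζ x h * u x = -∫ x, ζ x * g x := by
  have r1 : ContDiff ℝ (⊤ : ℕ∞) fun x => (ζ x).re := Complex.reCLM.contDiff.comp h1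
  have i1 : ContDiff ℝ (⊤ : ℕ∞) fun x => (ζ x).im := Complex.imCLM.contDiff.comp h1
  have r2 : HasCompactSupport fun x => (ζ x).re := h2.comp_left (g := Complex.re) rfl
  have i2 : HasCompactSupport fun x => (ζ x).im := h2.comp_left (g := Complex.im) rfl
  have dζ : ∀ x, HasFDerivAt ζ (fderiv ℝ ζ x) x := fun x =>
    (h1.differentiable (by simp) x).hasFDerivAt
  have dr : ∀ x, fderiv ℝ (fun x => (ζ x).re) x h = (fderiv ℝ ζ x h).re := fun x => by
    change fderiv ℝ (Complex.reCLM ∘ ζ) x h = _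
    rw [(Complex.reCLM.hasFDerivAt.comp x (dζ x)).fderiv]; rfl
  have di : ∀ x, fderiv ℝ (fun x => (ζ x).im) x h = (fderiv ℝ ζ x h).im := fun x => by
    change fderiv ℝ (Complex.imCLM ∘ ζ) x h = _
    rw [(Complex.imCLM.hasFDerivAt.comp x (dζ x)).fderiv]; rfl
  have er := hu.2.2 _ r1 r2
  have ei := hu.2.2 _ i1 i2
  have split : ∀ z w : ℂ, z * w = z.re • w + Complex.I * (z.im • w) := fun z w => by
    conv_lhs => rw [← Complex.re_add_im z]
    simp only [Complex.real_smul]; ring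
  have cr := hu.1.integrable_smul_left_of_hasCompactSupport (continuous_fderiv_apply r1 h)
    (hasCompactSupport_fderiv_apply r2 h)
  have ci := hu.1.integrable_smul_left_of_hasCompactSupport (continuous_fderiv_apply i1 h)
    (hasCompactSupport_fderiv_apply i2 h)
  simp only [dr, di] at er ei cr ci
  rw [integral_congr_ae (Eventually.of_forall fun x => split (fderiv ℝ ζ x h) (u x)),
    integral_congr_ae (Eventually.of_forall fun x => split (ζ x) (g x)),
    integral_add cr (ci.const_mul _), integral_const_mul, er, ei,
    integral_add (hu.2.1.integrable_smul_left_of_hasCompactSupport r1.continuous r2)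
      ((hu.2.1.integrable_smul_left_of_hasCompactSupport i1.continuous i2).const_mul _),
    integral_const_mul]
  ring

/-- The product rule with a smooth factor. -/
theorem mul_smooth (hu : HasWeakDir h u g) {χ : Rd d → ℝ} (hχ : ContDiff ℝ (⊤ : ℕ∞) χ) :
    HasWeakDir h (fun x => (χ x : ℂ) * u x)
      (fun x => (χ x : ℂ) * g x + (fderiv ℝ χ x h : ℂ) * u x) := by
  have cχ : Continuous fun x => (χ x : ℂ) := Complex.continuous_ofReal.comp hχ.continuous
  have cχ' : Continuous fun x => (fderiv ℝ χ x h : ℂ) :=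
    Complex.continuous_ofReal.comp (continuous_fderiv_apply hχ h)
  have lmul : ∀ {a b : Rd d → ℂ}, Continuous a → LocallyIntegrable b →
      LocallyIntegrable fun x => a x * b x := fun ha hb => by
    rw [← locallyIntegrableOn_univ] at hb ⊢
    exact hb.continuousOn_mul ha.continuousOn isOpen_univ.isLocallyClosed
  have l1 := lmul cχ hu.1
  have l2 := lmul cχ hu.2.1
  have l3 := lmul cχ' hu.1
  refine ⟨l1, l2.add l3, fun η h1 h2 => ?_⟩
  have hm := hu.2.2 (fun x => χ x * η x) (hχ.mul h1) (h2.mul_left)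
  have dm : ∀ x, fderiv ℝ (fun x => χ x * η x) x h
      = χ x * fderiv ℝ η x h + η x * fderiv ℝ χ x h := fun x => by
    rw [fderiv_fun_mul (hχ.differentiable (by simp) x) (h1.differentiable (by simp) x)]
    simp
  simp only [dm, add_smul] at hm
  have c1 := hasCompactSupport_fderiv_apply h2 h
  have i1 : Integrable fun x => (χ x * fderiv ℝ η x h) • u x :=
    hu.1.integrable_smul_left_of_hasCompactSupport
      (hχ.continuous.mul (continuous_fderiv_apply h1 h)) c1.mul_left
  have i2 : Integrable fun x => (η x * fderiv ℝ χ x h) • u x :=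
    hu.1.integrable_smul_left_of_hasCompactSupport
      (h1.continuous.mul (continuous_fderiv_apply hχ h)) h2.mul_right
  have i3 : Integrable fun x => (χ x * η x) • g x :=
    hu.2.1.integrable_smul_left_of_hasCompactSupport
      (hχ.continuous.mul h1.continuous) h2.mul_left
  rw [integral_add i1 i2] at hm
  have e1 : ∀ x, (fderiv ℝ η x h) • ((χ x : ℂ) * u x) = (χ x * fderiv ℝ η x h) • u x :=
    fun x => by simp only [Complex.real_smul]; push_cast; ring
  have e2 : ∀ x, η x • ((χ x : ℂ) * g x + (fderiv ℝ χ x h : ℂ) * u x)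
      = (χ x * η x) • g x + (η x * fderiv ℝ χ x h) • u x :=
    fun x => by simp only [Complex.real_smul]; push_cast; ring
  simp only [e1, e2]
  rw [integral_add i3 i2, eq_sub_of_add_eq hm]
  ring

/-- A translated test function, paired with `u`, is differentiable in the translation parameter,
and its derivative is the pairing with the weak derivative of `u`. -/
theorem hasDerivAt_integral_translate (hu : HasWeakDir h u g) {ζ : Rd d → ℂ}
    (h1 : ContDiff ℝ (⊤ : ℕ∞) ζ) (h2 : HasCompactSupport ζ) (t : ℝ) :
    HasDerivAt (fun s : ℝ => ∫ x, ζ (x - s • h) * u x) (∫ x, ζ (x - t • h) * g x) t := by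
  -- the pairing is the convolution of `u` with the reflection of `ζ`
  set ξ : Rd d → ℂ := fun x => ζ (-x) with hξ
  have ξ1 : ContDiff ℝ (⊤ : ℕ∞) ξ := h1.comp contDiff_neg
  have ξ2 : HasCompactSupport ξ := h2.comp_homeomorph (Homeomorph.neg _)
  have key := HasCompactSupport.hasFDerivAt_convolution_right (μ := volume)
    (ContinuousLinearMap.mul ℝ ℂ) ξ2 hu.1 (ξ1.of_le (by simp)) (t • h)
  have line : HasDerivAt (fun s : ℝ => s • h) h t := by
    simpa using (hasDerivAt_id t).smul_const h
  have key2 := key.comp_hasDerivAt t line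
  have tr1 : ContDiff ℝ (⊤ : ℕ∞) fun x => ζ (x - t • h) := h1.comp (contDiff_id.sub contDiff_const)
  have tr2 : HasCompactSupport fun x => ζ (x - t • h) := by
    simpa [sub_eq_add_neg, Function.comp_def] using
      h2.comp_homeomorph (Homeomorph.addRight (-(t • h)))
  have parts := hu.integral_fderiv_mul tr1 tr2
  have dξ : ∀ y, fderiv ℝ ξ y h = -fderiv ℝ ζ (-y) h := fun y => by
    have := ((h1.differentiable (by simp) (-y)).hasFDerivAt.comp y (hasFDerivAt_id y).neg).fderiv
    change fderiv ℝ (ζ ∘ Neg.neg) y h = _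
    rw [this]; simp
  have dtr : ∀ y, fderiv ℝ (fun x => ζ (x - t • h)) y h = fderiv ℝ ζ (y - t • h) h := fun y => by
    have := ((h1.differentiable (by simp) (y - t • h)).hasFDerivAt.comp y
      ((hasFDerivAt_id y).sub_const (t • h))).fderiv
    change fderiv ℝ (ζ ∘ fun x => id x - t • h) y h = _
    rw [this]; simp
  have conv : HasCompactSupport (fderiv ℝ ξ) := ξ2.fderiv ℝ
  have ex := HasCompactSupport.convolutionExists_right
    ((ContinuousLinearMap.mul ℝ ℂ).precompR (Rd d)) conv hu.1
    (ξ1.continuous_fderiv (by simp)) (t • h)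
  have e1 : (fun s : ℝ => ∫ x, ζ (x - s • h) * u x)
      = convolution u ξ (ContinuousLinearMap.mul ℝ ℂ) volume ∘ fun s => s • h := by
    funext s
    simp only [Function.comp, convolution_def, ContinuousLinearMap.mul_apply', hξ]
    refine integral_congr_ae (Eventually.of_forall fun x => ?_)
    simp only [neg_sub]; ring
  have e2 : ∫ x, ζ (x - t • h) * g x = (convolution u (fderiv ℝ ξ)
      ((ContinuousLinearMap.mul ℝ ℂ).precompR (Rd d)) volume (t • h)) h := by
    rw [convolution_def, ContinuousLinearMap.integral_apply ex, ← neg_eq_iff_eq_neg.mpr parts,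
      ← integral_neg]
    refine integral_congr_ae (Eventually.of_forall fun x => ?_)
    change -(fderiv ℝ (fun x => ζ (x - t • h)) x h * u x) = u x * fderiv ℝ ξ (t • h - x) h
    rw [dξ, dtr, neg_sub]
    ring
  rw [e1, e2]
  exact key2

end HasWeakDir

/-! ### Translations and integration by parts in `L²` -/

theorem inner_toLp {u v : Rd d → ℂ} (hu : MemLp u 2) (hv : MemLp v 2) :
    inner ℂ (hv.toLp v) (hu.toLp u) = ∫ x, u x * conj (v x) := by
  rw [L2.inner_def]
  refine integral_congr_ae ?_
  filter_upwards [hu.coeFn_toLp, hv.coeFn_toLp] with x h1 h2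
  rw [h1, h2, RCLike.inner_apply]

theorem integral_norm_sq_eq {u : Rd d → ℂ} (hu : MemLp u 2) :
    ∫ x, ‖u x‖ ^ 2 = ‖hu.toLp u‖ ^ 2 := by
  have h := inner_toLp hu hu
  rw [inner_self_eq_norm_sq_to_K] at h
  have e : ∀ x, u x * conj (u x) = ((‖u x‖ ^ 2 : ℝ) : ℂ) := fun x => by
    rw [Complex.mul_conj, Complex.normSq_eq_norm_sq]
  simp only [e] at h
  rw [integral_complex_ofReal] at h
  exact Complex.ofReal_injective (by rw [← h]; simp)

theorem normL2_eq {u : Rd d → ℂ} (hu : MemLp u 2) : normL2 u = ‖hu.toLp u‖ := by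
  rw [normL2, integral_norm_sq_eq hu, Real.sqrt_sq (norm_nonneg _)]

theorem memLp_translate {u : Rd d → ℂ} (hu : MemLp u 2) (h : Rd d) :
    MemLp (fun x => u (x + h)) 2 :=
  hu.comp_measurePreserving (measurePreserving_add_right volume h)

theorem norm_toLp_translate {u : Rd d → ℂ} (hu : MemLp u 2) (h : Rd d) :
    ‖(memLp_translate hu h).toLp _‖ = ‖hu.toLp u‖ := by
  rw [← normL2_eq, ← normL2_eq hu, normL2, normL2,
    integral_add_right_eq_self (fun x => ‖u x‖ ^ 2) h]

theorem memLp_conj {u : Rd d → ℂ} (hu : MemLp u 2) : MemLp (fun x => conj (u x)) 2 :=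
  hu.star

theorem norm_integral_mul_le {u v : Rd d → ℂ} (hu : MemLp u 2) (hv : MemLp v 2) :
    ‖∫ x, u x * v x‖ ≤ ‖hu.toLp u‖ * ‖hv.toLp v‖ := by
  have h := norm_inner_le_norm (𝕜 := ℂ) ((memLp_conj hu).toLp _) (hv.toLp v)
  rw [inner_toLp hv (memLp_conj hu)] at h
  have e : ‖(memLp_conj hu).toLp _‖ = ‖hu.toLp u‖ := by
    rw [← normL2_eq, ← normL2_eq hu]
    simp [normL2]
  rw [e] at h
  simpa [mul_comm] using h

/-- It suffices to check a closed condition on `L²` on the classes of test functions. -/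
theorem induction_testFunction {P : Lp ℂ 2 (volume : Measure (Rd d)) → Prop}
    (hP : IsClosed {Z | P Z})
    (h : ∀ (ζ : Rd d → ℂ) (_ : ContDiff ℝ (⊤ : ℕ∞) ζ) (_ : HasCompactSupport ζ)
      (h3 : MemLp ζ 2), P (h3.toLp ζ)) (Z : Lp ℂ 2 (volume : Measure (Rd d))) : P Z := by
  have hd := Lp.dense_hasCompactSupport_contDiff (E := Rd d) (F := ℂ) (μ := volume) (p := 2)
    (by simp)
  refine hd.induction (P := P) ?_ hP Z
  rintro f ⟨ζ, h1, h2, h3⟩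
  have hm : MemLp ζ 2 := (memLp_congr_ae h1).mp (Lp.memLp f)
  have : hm.toLp ζ = f := by
    rw [← Lp.toLp_coeFn f (Lp.memLp f)]
    exact MemLp.toLp_congr _ _ h1.symm
  exact this ▸ h ζ h3 h2 hm

namespace HasWeakDir

variable {h : Rd d} {u g v f : Rd d → ℂ}

theorem inner_translate_sub (hu : MemLp u 2 volume) {ζ : Rd d → ℂ}
    (hζ : MemLp ζ 2 volume) (k : Rd d) :
    inner ℂ (hζ.toLp ζ) ((memLp_translate hu k).toLp _ - hu.toLp u)
      = (∫ x, conj (ζ (x - k)) * u x) - ∫ x, conj (ζ x) * u x := by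
  rw [inner_sub_right, inner_toLp, inner_toLp,
    ← integral_add_right_eq_self (fun x => conj (ζ (x - k)) * u x) k]
  simp only [add_sub_cancel_right, mul_comm]

/-- Translating `u` along `h` moves it in `L²` by at most the norm of the derivative
along `h`. -/
theorem norm_translate_sub_le (H : HasWeakDir h u g) (hu : MemLp u 2 volume)
    (hg : MemLp g 2 volume) :
    ‖(memLp_translate hu h).toLp _ - hu.toLp u‖ ≤ ‖hg.toLp g‖ := by
  set D := (memLp_translate hu h).toLp _ - hu.toLp u with hD
  -- by density, it is enough to pair the increment with test functions and use the mean value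
  -- inequality for the translation parameter
  have key : ∀ Z : Lp ℂ 2 (volume : Measure (Rd d)), ‖inner ℂ Z D‖ ≤ ‖Z‖ * ‖hg.toLp g‖ := by
    refine induction_testFunction (isClosed_le (by fun_prop) (by fun_prop)) ?_
    intro ζ h1 h2 h3
    have c1 : ContDiff ℝ (⊤ : ℕ∞) fun x => conj (ζ x) :=
      Complex.conjCLE.contDiff.comp h1
    have c2 : HasCompactSupport fun x => conj (ζ x) := h2.comp_left (g := conj) (by simp)
    have mv := Convex.norm_image_sub_le_of_norm_hasDerivWithin_le
      (f := fun s : ℝ => ∫ x, conj (ζ (x - s • h)) * u x)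
      (f' := fun s : ℝ => ∫ x, conj (ζ (x - s • h)) * g x)
      (C := ‖h3.toLp ζ‖ * ‖hg.toLp g‖) (s := Set.univ) (x := 0) (y := 1)
      (fun s _ => (H.hasDerivAt_integral_translate c1 c2 s).hasDerivWithinAt)
      (fun s _ => by
        have ht := memLp_conj (memLp_translate h3 (-(s • h)))
        have := norm_integral_mul_le ht hg
        rw [← normL2_eq ht] at this
        have e : normL2 (fun x => conj (ζ (x + -(s • h)))) = ‖h3.toLp ζ‖ := by
          rw [← norm_toLp_translate h3 (-(s • h)), ← normL2_eq]
          simp [normL2]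
        rw [e] at this
        simpa only [sub_eq_add_neg] using this)
      convex_univ trivial trivial
    rw [hD, inner_translate_sub hu h3]
    simpa using mv
  by_cases h0 : ‖D‖ = 0
  · rw [h0]; positivity
  have := key D
  rw [norm_inner_symm, inner_self_eq_norm_sq_to_K] at this
  have h2 : ‖D‖ * ‖D‖ ≤ ‖D‖ * ‖hg.toLp g‖ := by
    simpa [sq] using this
  exact le_of_mul_le_mul_left h2 (lt_of_le_of_ne (norm_nonneg _) (Ne.symm h0))

/-- Difference quotients converge weakly in `L²` to the weak derivative. -/
theorem tendsto_inner_differenceQuotient (H : HasWeakDir h u g) (hu : MemLp u 2 volume)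
    (hg : MemLp g 2 volume) (Z : Lp ℂ 2 (volume : Measure (Rd d))) :
    Tendsto (fun t : ℝ => ((t : ℂ))⁻¹ *
      inner ℂ Z ((memLp_translate hu (t • h)).toLp _ - hu.toLp u)) (𝓝[≠] 0)
      (𝓝 (inner ℂ Z (hg.toLp g))) := by
  set D : ℝ → Lp ℂ 2 (volume : Measure (Rd d)) :=
    fun t => (memLp_translate hu (t • h)).toLp _ - hu.toLp u with hD
  have bound : ∀ t : ℝ, t ≠ 0 → ∀ W : Lp ℂ 2 (volume : Measure (Rd d)),
      ‖((t : ℂ))⁻¹ * inner ℂ W (D t)‖ ≤ ‖W‖ * ‖hg.toLp g‖ := fun t ht W => by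
    have h1 := (H.smul_dir t).norm_translate_sub_le hu (hg.const_smul (t : ℂ))
    rw [MemLp.toLp_const_smul _ hg, norm_smul, Complex.norm_real] at h1
    rw [norm_mul, norm_inv, Complex.norm_real]
    have h2 : ‖inner ℂ W (D t)‖ ≤ ‖W‖ * (‖t‖ * ‖hg.toLp g‖) :=
      (norm_inner_le_norm _ _).trans (by gcongr)
    have h3 : 0 < ‖t‖ := norm_pos_iff.mpr ht
    calc ‖t‖⁻¹ * ‖inner ℂ W (D t)‖ ≤ ‖t‖⁻¹ * (‖W‖ * (‖t‖ * ‖hg.toLp g‖)) := by gcongr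
      _ = ‖W‖ * ‖hg.toLp g‖ := by field_simp
  -- the uniform bound on the quotients makes the set of good `Z` closed
  refine induction_testFunction (P := fun Z => Tendsto (fun t : ℝ => ((t : ℂ))⁻¹ *
      inner ℂ Z (D t)) (𝓝[≠] 0) (𝓝 (inner ℂ Z (hg.toLp g)))) ?_ ?_ Z
  · refine isClosed_of_closure_subset fun W hW => ?_
    rw [Set.mem_ofPred_eq, Metric.tendsto_nhds]
    intro ε hε
    obtain ⟨W', hW', hd⟩ := Metric.mem_closure_iff.mp hW (ε / (3 * (‖hg.toLp g‖ + 1)))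
      (by positivity)
    rw [dist_eq_norm, lt_div_iff₀ (by positivity)] at hd
    have hd' : ‖W - W'‖ * ‖hg.toLp g‖ ≤ ε / 3 := by nlinarith [norm_nonneg (W - W')]
    filter_upwards [(Metric.tendsto_nhds.mp hW') (ε / 3) (by positivity),
      self_mem_nhdsWithin] with t h1 h2
    rw [dist_eq_norm] at h1 ⊢
    have b1 := bound t h2 (W - W')
    have b2 := norm_inner_le_norm (𝕜 := ℂ) (W - W') (hg.toLp g)
    have e : ((t : ℂ))⁻¹ * inner ℂ W (D t) - inner ℂ W (hg.toLp g)
        = (((t : ℂ))⁻¹ * inner ℂ W' (D t) - inner ℂ W' (hg.toLp g))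
          + ((t : ℂ))⁻¹ * inner ℂ (W - W') (D t) - inner ℂ (W - W') (hg.toLp g) := by
      rw [inner_sub_left, inner_sub_left]; ring
    rw [e]
    refine (norm_sub_le _ _).trans_lt ?_
    have := norm_add_le (((t : ℂ))⁻¹ * inner ℂ W' (D t) - inner ℂ W' (hg.toLp g))
      (((t : ℂ))⁻¹ * inner ℂ (W - W') (D t))
    linarith
  · intro ζ h1 h2 h3
    have c1 : ContDiff ℝ (⊤ : ℕ∞) fun x => conj (ζ x) :=
      Complex.conjCLE.contDiff.comp h1
    have c2 : HasCompactSupport fun x => conj (ζ x) := h2.comp_left (g := conj) (by simp)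
    have := (H.hasDerivAt_integral_translate c1 c2 0)
    rw [hasDerivAt_iff_tendsto_slope] at this
    have e1 : ∫ x, conj (ζ (x - (0 : ℝ) • h)) * g x = inner ℂ (h3.toLp ζ) (hg.toLp g) := by
      rw [inner_toLp]; simp [mul_comm]
    rw [e1] at this
    refine this.congr fun t => ?_
    rw [hD, inner_translate_sub hu h3, slope_def_module, Complex.real_smul]
    simp

/-- Integration by parts for two functions which are in `L²` together with their weak
derivatives. -/
theorem integral_mul_conj (Hu : HasWeakDir h u g) (Hv : HasWeakDir h v f) (hu : MemLp u 2 volume)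
    (hg : MemLp g 2 volume) (hv : MemLp v 2 volume) (hf : MemLp f 2 volume) :
    ∫ x, g x * conj (v x) = -∫ x, u x * conj (f x) := by
  have t1 := Hu.tendsto_inner_differenceQuotient hu hg (hv.toLp v)
  have t2 := Hv.tendsto_inner_differenceQuotient hv hf (hu.toLp u)
  have neg : Tendsto (fun t : ℝ => -t) (𝓝[≠] 0) (𝓝[≠] 0) := by
    refine tendsto_nhdsWithin_iff.mpr ⟨?_, ?_⟩
    · have : Tendsto (fun t : ℝ => -t) (𝓝 0) (𝓝 (-0)) := continuous_neg.tendsto 0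
      rw [neg_zero] at this
      exact this.mono_left nhdsWithin_le_nhds
    · filter_upwards [self_mem_nhdsWithin] with t ht
      simpa using ht
  have t3 := ((Complex.continuous_conj.tendsto _).comp (t2.comp neg)).neg
  have e : ∀ t : ℝ, ((t : ℂ))⁻¹ * inner ℂ (hv.toLp v)
        ((memLp_translate hu (t • h)).toLp _ - hu.toLp u)
      = -conj ((((-t : ℝ) : ℂ))⁻¹ * inner ℂ (hu.toLp u)
        ((memLp_translate hv ((-t) • h)).toLp _ - hv.toLp v)) := fun t => by
    -- move the translation to the other factor by invariance of Lebesgue measure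
    rw [map_mul, inner_conj_symm, map_inv₀, Complex.conj_ofReal, inner_sub_left, inner_sub_right,
      inner_toLp, inner_toLp, inner_toLp,
      ← integral_add_right_eq_self (fun x => u x * conj (v (x + -t • h))) (t • h)]
    simp only [neg_smul, add_neg_cancel_right]
    push_cast
    rw [inv_neg]
    ring
  have := tendsto_nhds_unique (t1.congr e) t3
  rw [inner_toLp hg hv, inner_conj_symm, inner_toLp hu hf] at this
  exact this

end HasWeakDir

/-! ### The energy space as a vector space -/

theorem weakPartial_ae_eq {i : Fin d} {u g : Rd d → ℂ} (H : HasWeakPartial i u g) :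
    weakPartial i u =ᵐ[volume] g := by
  have hex : ∃ g, HasWeakPartial i u g := ⟨g, H⟩
  rw [weakPartial, dif_pos hex]
  exact HasWeakDir.unique (h := EuclideanSpace.single i 1) hex.choose_spec H

theorem MemH1.hasWeakDir {u : Rd d → ℂ} (hu : MemH1 u) (i : Fin d) :
    HasWeakDir (EuclideanSpace.single i 1) u (weakPartial i u) := by
  obtain ⟨g, hg, -⟩ := hu.2 i
  exact HasWeakDir.congr_ae (h := EuclideanSpace.single i 1) hg (ae_eq_refl _)
    (weakPartial_ae_eq hg).symm

theorem MemH1.memLp_weakPartial {u : Rd d → ℂ} (hu : MemH1 u) (i : Fin d) :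
    MemLp (weakPartial i u) 2 := by
  obtain ⟨g, hg, hm⟩ := hu.2 i
  exact (memLp_congr_ae (weakPartial_ae_eq hg)).mpr hm

theorem MemH1.add {u v : Rd d → ℂ} (hu : MemH1 u) (hv : MemH1 v) : MemH1 (u + v) :=
  ⟨hu.1.add hv.1, fun i => ⟨_, (hu.hasWeakDir i).add (hv.hasWeakDir i),
    (hu.memLp_weakPartial i).add (hv.memLp_weakPartial i)⟩⟩

theorem MemH1.const_smul {u : Rd d → ℂ} (hu : MemH1 u) (c : ℂ) : MemH1 (c • u) :=
  ⟨hu.1.const_smul c, fun i => ⟨_, (hu.hasWeakDir i).const_smul c,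
    (hu.memLp_weakPartial i).const_smul c⟩⟩

theorem weakPartial_add {u v : Rd d → ℂ} (hu : MemH1 u) (hv : MemH1 v) (i : Fin d) :
    weakPartial i (u + v) =ᵐ[volume] weakPartial i u + weakPartial i v :=
  weakPartial_ae_eq ((hu.hasWeakDir i).add (hv.hasWeakDir i))

theorem weakPartial_const_smul {u : Rd d → ℂ} (hu : MemH1 u) (c : ℂ) (i : Fin d) :
    weakPartial i (c • u) =ᵐ[volume] c • weakPartial i u :=
  weakPartial_ae_eq ((hu.hasWeakDir i).const_smul c)

section

variable {V : Rd d → ℝ}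

theorem norm_sqrt_mul_sq {a : ℝ} (ha : 0 ≤ a) (z : ℂ) :
    ‖((√a : ℝ) : ℂ) * z‖ ^ 2 = a * ‖z‖ ^ 2 := by
  rw [norm_mul, mul_pow, Complex.norm_real, Real.norm_eq_abs, sq_abs, Real.sq_sqrt ha]

/-- Membership in the energy space in terms of `L²` membership alone, which makes its linearity and
completeness those of `L²`. -/
theorem mem_X_iff (hV : Measurable V) (hV0 : ∀ x, 0 ≤ V x) {u : Rd d → ℂ} :
    u ∈ X V ↔ MemH1 u ∧ MemLp (fun x => ((√(V x) : ℝ) : ℂ) * u x) 2 := by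
  refine and_congr_right fun hu => ?_
  have hm : AEStronglyMeasurable (fun x => ((√(V x) : ℝ) : ℂ) * u x) volume :=
    (Complex.measurable_ofReal.comp hV.sqrt).aestronglyMeasurable.mul hu.1.1
  rw [memLp_two_iff_integrable_sq_norm hm]
  simp only [norm_sqrt_mul_sq (hV0 _)]

theorem X_add (hV : Measurable V) (hV0 : ∀ x, 0 ≤ V x) {u v : Rd d → ℂ}
    (hu : u ∈ X V) (hv : v ∈ X V) : u + v ∈ X V := by
  rw [mem_X_iff hV hV0] at *
  refine ⟨hu.1.add hv.1, ?_⟩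
  have := hu.2.add hv.2
  refine (memLp_congr_ae (Eventually.of_forall fun x => ?_)).mp this
  simp only [Pi.add_apply]; ring

theorem X_smul (hV : Measurable V) (hV0 : ∀ x, 0 ≤ V x) {u : Rd d → ℂ}
    (hu : u ∈ X V) (c : ℂ) : c • u ∈ X V := by
  rw [mem_X_iff hV hV0] at *
  refine ⟨hu.1.const_smul c, ?_⟩
  have := hu.2.const_smul c
  refine (memLp_congr_ae (Eventually.of_forall fun x => ?_)).mp this
  simp only [Pi.smul_apply, smul_eq_mul]; ring

theorem X_sub (hV : Measurable V) (hV0 : ∀ x, 0 ≤ V x) {u v : Rd d → ℂ}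
    (hu : u ∈ X V) (hv : v ∈ X V) : u - v ∈ X V := by
  have := X_add hV hV0 hu (X_smul hV hV0 hv (-1))
  rwa [neg_one_smul, ← sub_eq_add_neg] at this

theorem X_zero : (0 : Rd d → ℂ) ∈ X V := by
  refine ⟨⟨MemLp.zero, fun i => ⟨0, ⟨locallyIntegrable_zero, locallyIntegrable_zero, ?_⟩,
    MemLp.zero⟩⟩, ?_⟩ <;> simp

/-! ### Admissible rotation speeds -/

/-- The quantitative form of `|Ω| < Ω_max`: the centrifugal potential is dominated by a fraction
of the trapping potential, up to a constant. It also holds, with `θ = 0`, for `Ω = 0`. -/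
structure SubcriticalRotation (V : Rd d → ℝ) (Ω θ C : ℝ) : Prop where
  theta_nonneg : 0 ≤ θ
  theta_lt_one : θ < 1
  const_nonneg : 0 ≤ C
  bound : ∀ x, Ω ^ 2 * axisDistSq x ≤ 2 * θ ^ 2 * (V x + C)

theorem axisDistSq_le (x : Rd d) : axisDistSq x ≤ ‖x‖ ^ 2 := by
  unfold axisDistSq
  split_ifs with h
  · rw [EuclideanSpace.norm_sq_eq]
    have hne : (⟨0, by omega⟩ : Fin d) ≠ ⟨1, by omega⟩ := by simp
    rw [← Finset.sum_pair (f := fun i => x i ^ 2) hne]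
    simp only [Real.norm_eq_abs, sq_abs]
    exact Finset.sum_le_sum_of_subset_of_nonneg (Finset.subset_univ _) fun _ _ _ => sq_nonneg _
  · positivity

theorem exists_subcriticalRotation (hV0 : ∀ x, 0 ≤ V x) {Ω : ℝ}
    (hΩ : Ω = 0 ∨ ((|Ω| : ℝ) : EReal) < OmegaMax V) :
    ∃ θ C, SubcriticalRotation V Ω θ C := by
  rcases hΩ with rfl | hΩ
  · exact ⟨0, 0, le_rfl, one_pos, le_rfl, fun x => by simp⟩
  obtain ⟨_, ⟨γ, ⟨hγ, hlim⟩, rfl⟩, hlt⟩ := lt_sSup_iff.mp hΩ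
  have hlt : |Ω| < γ := EReal.coe_lt_coe_iff.mp hlt
  obtain ⟨R, hR⟩ := (Metric.hasBasis_cobounded_compl_closedBall (0 : Rd d)).eventually_iff.mp
    (by rw [Metric.cobounded_eq_cocompact]; exact hlim.eventually_ge_atTop 0)
  -- `V - γ²/2 r²` is nonnegative outside the ball of radius `R` and at least `-γ²/2 R²` inside
  refine ⟨|Ω| / γ, γ ^ 2 / 2 * R ^ 2, by positivity, (div_lt_one hγ).mpr hlt, by positivity,
    fun x => ?_⟩
  have key : γ ^ 2 / 2 * axisDistSq x ≤ V x + γ ^ 2 / 2 * R ^ 2 := by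
    by_cases hx : x ∈ Metric.closedBall (0 : Rd d) R
    · rw [mem_closedBall_zero_iff] at hx
      have h1 : axisDistSq x ≤ R ^ 2 :=
        (axisDistSq_le x).trans (by gcongr)
      have : γ ^ 2 / 2 * axisDistSq x ≤ γ ^ 2 / 2 * R ^ 2 := by gcongr
      linarith [hV0 x]
    · have h1 := hR.2 hx
      have : 0 ≤ γ ^ 2 / 2 * R ^ 2 := by positivity
      linarith
  have e : Ω ^ 2 * axisDistSq x = 2 * (|Ω| / γ) ^ 2 * (γ ^ 2 / 2 * axisDistSq x) := by
    rw [div_pow, sq_abs]; field_simp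
  rw [e]
  gcongr

/-! ### The angular momentum -/

theorem norm_angMom_sq_le (u : Rd d → ℂ) (x : Rd d) :
    ‖angMom u x‖ ^ 2 ≤ axisDistSq x * ∑ i, ‖weakPartial i u x‖ ^ 2 := by
  unfold angMom axisDistSq
  split_ifs with h
  · have hne : (⟨0, by omega⟩ : Fin d) ≠ ⟨1, by omega⟩ := by simp
    have h1 : ‖weakPartial ⟨0, by omega⟩ u x‖ ^ 2 + ‖weakPartial ⟨1, by omega⟩ u x‖ ^ 2
        ≤ ∑ i, ‖weakPartial i u x‖ ^ 2 := by
      rw [← Finset.sum_pair (f := fun i => ‖weakPartial i u x‖ ^ 2) hne]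
      exact Finset.sum_le_sum_of_subset_of_nonneg (Finset.subset_univ _) fun _ _ _ => sq_nonneg _
    refine le_trans ?_ (mul_le_mul_of_nonneg_left h1 (by positivity))
    rw [norm_mul, Complex.norm_I, one_mul]
    have h2 := norm_sub_le ((x ⟨1, by omega⟩ : ℂ) * weakPartial ⟨0, by omega⟩ u x)
      ((x ⟨0, by omega⟩ : ℂ) * weakPartial ⟨1, by omega⟩ u x)
    rw [norm_mul, norm_mul, Complex.norm_real, Complex.norm_real, Real.norm_eq_abs,
      Real.norm_eq_abs] at h2
    refine (pow_le_pow_left₀ (norm_nonneg _) h2 2).trans ?_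
    set a := ‖weakPartial ⟨0, by omega⟩ u x‖
    set b := ‖weakPartial ⟨1, by omega⟩ u x‖
    rw [← sq_abs (x ⟨0, _⟩), ← sq_abs (x ⟨1, _⟩)]
    nlinarith [sq_nonneg (|x ⟨0, by omega⟩| * a - |x ⟨1, by omega⟩| * b)]
  · simp

/-- The rotation term is dominated by the energy density with the factor `θ < 1`: by Young's
inequality, as `|Ω| r ≤ θ (2 (V + C))^{1/2}`, where `r` is the distance to the axis. -/
theorem SubcriticalRotation.norm_le {Ω θ C : ℝ} (hS : SubcriticalRotation V Ω θ C)
    (hV0 : ∀ x, 0 ≤ V x) (u v : Rd d → ℂ) (x : Rd d) :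
    ‖(Ω : ℂ) * (conj (v x) * angMom u x)‖
      ≤ θ * (1 / 2 * ∑ i, ‖weakPartial i u x‖ ^ 2 + (V x * ‖v x‖ ^ 2 + C * ‖v x‖ ^ 2)) := by
  have hG : 0 ≤ ∑ i, ‖weakPartial i u x‖ ^ 2 := Finset.sum_nonneg fun _ _ => sq_nonneg _
  have hθ := hS.theta_nonneg
  have hW : 0 ≤ V x + C := add_nonneg (hV0 x) hS.const_nonneg
  refine le_of_sq_le_sq ?_ (mul_nonneg hθ (by rw [← add_mul]; positivity))
  rw [norm_mul, norm_mul, Complex.norm_real, mul_pow, mul_pow, Real.norm_eq_abs, sq_abs,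
    RCLike.norm_conj]
  set G := ∑ i, ‖weakPartial i u x‖ ^ 2
  calc Ω ^ 2 * (‖v x‖ ^ 2 * ‖angMom u x‖ ^ 2)
      ≤ Ω ^ 2 * (‖v x‖ ^ 2 * (axisDistSq x * G)) := by
        gcongr; exact norm_angMom_sq_le u x
    _ = (Ω ^ 2 * axisDistSq x) * (‖v x‖ ^ 2 * G) := by ring
    _ ≤ (2 * θ ^ 2 * (V x + C)) * (‖v x‖ ^ 2 * G) := by
        exact mul_le_mul_of_nonneg_right (hS.bound x) (by positivity)
    _ ≤ _ := by
        nlinarith [mul_nonneg (sq_nonneg θ) (sq_nonneg (1 / 2 * G - (V x + C) * ‖v x‖ ^ 2))]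

theorem measurable_coord (i : Fin d) : Measurable fun x : Rd d => (x i : ℂ) :=
  (Complex.continuous_ofReal.comp (EuclideanSpace.proj (𝕜 := ℝ) i).continuous).measurable

theorem MemH1.aestronglyMeasurable_angMom {u : Rd d → ℂ} (hu : MemH1 u) :
    AEStronglyMeasurable (angMom u) volume := by
  unfold angMom
  split_ifs with h
  · exact (((measurable_coord _).aestronglyMeasurable.mul (hu.memLp_weakPartial _).1).sub
      ((measurable_coord _).aestronglyMeasurable.mul (hu.memLp_weakPartial _).1)).const_mul _
  · exact aestronglyMeasurable_zero

theorem MemH1.integrable_norm_sq {u : Rd d → ℂ} (hu : MemH1 u) :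
    Integrable fun x => ‖u x‖ ^ 2 :=
  (memLp_two_iff_integrable_sq_norm hu.1.1).mp hu.1

theorem MemH1.integrable_grad {u : Rd d → ℂ} (hu : MemH1 u) :
    Integrable fun x => ∑ i, ‖weakPartial i u x‖ ^ 2 :=
  integrable_finsetSum _ fun i _ =>
    (memLp_two_iff_integrable_sq_norm (hu.memLp_weakPartial i).1).mp (hu.memLp_weakPartial i)

/-- The factor `Ω` belongs to the integrand: for `Ω = 0` the potential need not dominate `r²`, and
`v̄ L_z u` itself may fail to be integrable. -/
theorem SubcriticalRotation.integrable {Ω θ C : ℝ} (hS : SubcriticalRotation V Ω θ C)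
    (hV0 : ∀ x, 0 ≤ V x) {u v : Rd d → ℂ} (hu : u ∈ X V) (hv : v ∈ X V) :
    Integrable fun x => (Ω : ℂ) * (conj (v x) * angMom u x) := by
  refine Integrable.mono' (((hu.1.integrable_grad.const_mul (1 / 2)).add
    (hv.2.add (hv.1.integrable_norm_sq.const_mul C))).const_mul θ) ?_
    (Eventually.of_forall fun x => hS.norm_le hV0 u v x)
  exact ((memLp_conj hv.1.1).1.mul hu.1.aestronglyMeasurable_angMom).const_mul _

theorem angMom_add {u v : Rd d → ℂ} (hu : MemH1 u) (hv : MemH1 v) :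
    angMom (u + v) =ᵐ[volume] angMom u + angMom v := by
  unfold angMom
  split_ifs with h
  · filter_upwards [weakPartial_add hu hv ⟨0, by omega⟩, weakPartial_add hu hv ⟨1, by omega⟩]
      with x h1 h2
    simp only [Pi.add_apply, h1, h2]; ring
  · simp

theorem angMom_const_smul {u : Rd d → ℂ} (hu : MemH1 u) (c : ℂ) :
    angMom (c • u) =ᵐ[volume] c • angMom u := by
  unfold angMom
  split_ifs with h
  · filter_upwards [weakPartial_const_smul hu c ⟨0, by omega⟩,
      weakPartial_const_smul hu c ⟨1, by omega⟩] with x h1 h2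
    simp only [Pi.smul_apply, smul_eq_mul, h1, h2]; ring
  · simp

end

/-! ### Symmetry of the angular momentum -/

/-- A smooth radial cutoff function, equal to `1` for `‖x‖ ≤ n + 1` and compactly supported. -/
def radialCutoff (n : ℕ) (x : Rd d) : ℝ :=
  (⟨1, 2, one_pos, one_lt_two⟩ : ContDiffBump (0 : ℝ)) (‖x‖ ^ 2 / ((n : ℝ) + 1) ^ 2)

theorem contDiff_radialCutoff (n : ℕ) :
    ContDiff ℝ (⊤ : ℕ∞) (radialCutoff n : Rd d → ℝ) :=
  (ContDiffBump.contDiff _).comp ((contDiff_norm_sq ℝ).div_const _)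

theorem hasCompactSupport_radialCutoff (n : ℕ) :
    HasCompactSupport (radialCutoff n : Rd d → ℝ) := by
  refine HasCompactSupport.of_support_subset_isCompact
    (isCompact_closedBall (0 : Rd d) (2 * ((n : ℝ) + 1))) fun x hx => ?_
  rw [mem_closedBall_zero_iff]
  by_contra hlt
  refine hx (ContDiffBump.zero_of_le_dist _ ?_)
  rw [dist_zero_right, Real.norm_of_nonneg (by positivity)]
  change (2 : ℝ) ≤ _
  rw [le_div_iff₀ (by positivity)]
  push Not at hlt
  have h0 : 0 < (n : ℝ) + 1 := by positivity
  nlinarith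

theorem norm_radialCutoff_le (n : ℕ) (x : Rd d) : ‖(radialCutoff n x : ℂ)‖ ≤ 1 := by
  rw [Complex.norm_real, Real.norm_of_nonneg (show 0 ≤ radialCutoff n x from ContDiffBump.nonneg _)]
  exact ContDiffBump.le_one _

theorem radialCutoff_eq_one {n : ℕ} {x : Rd d} (h : ‖x‖ ≤ n + 1) : radialCutoff n x = 1 := by
  refine ContDiffBump.one_of_mem_closedBall _ ?_
  rw [mem_closedBall_zero_iff, Real.norm_of_nonneg (by positivity)]
  change _ ≤ (1 : ℝ)
  rw [div_le_one (by positivity)]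
  gcongr

/-- The gradient of a radial function is radial. -/
theorem exists_fderiv_radialCutoff (n : ℕ) (x : Rd d) :
    ∃ c : ℝ, ∀ i, fderiv ℝ (radialCutoff n) x (EuclideanSpace.single i 1) = c * x i := by
  set b : ContDiffBump (0 : ℝ) := ⟨1, 2, one_pos, one_lt_two⟩ with hb
  set a : ℝ := ((n : ℝ) + 1) ^ 2 with ha
  have h1 : HasFDerivAt (fun y : Rd d => ‖y‖ ^ 2 / a) (a⁻¹ • (2 • innerSL ℝ x)) x := by
    have := (hasStrictFDerivAt_norm_sq x).hasFDerivAt.mul_const a⁻¹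
    simpa [div_eq_mul_inv] using this
  have h2 : HasDerivAt b (deriv b (‖x‖ ^ 2 / a)) (‖x‖ ^ 2 / a) :=
    ((b.contDiff (n := 1)).differentiable one_ne_zero _).hasDerivAt
  have h3 := (h2.comp_hasFDerivAt x h1).fderiv
  refine ⟨deriv b (‖x‖ ^ 2 / a) * a⁻¹ * 2, fun i => ?_⟩
  change fderiv ℝ (b ∘ fun y : Rd d => ‖y‖ ^ 2 / a) x _ = _
  rw [h3]
  simp [EuclideanSpace.inner_single_right]
  ring

theorem tendsto_integral_radialCutoff {F : Rd d → ℂ} (hF : Integrable F) :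
    Tendsto (fun n => ∫ x, (radialCutoff n x : ℂ) * F x) atTop (𝓝 (∫ x, F x)) := by
  refine tendsto_integral_of_dominated_convergence (fun x => ‖F x‖)
    (fun n => ((Complex.continuous_ofReal.comp
      (contDiff_radialCutoff n).continuous).aestronglyMeasurable).mul hF.1) hF.norm
    (fun n => Eventually.of_forall fun x => ?_) (Eventually.of_forall fun x => ?_)
  · rw [norm_mul]
    exact mul_le_of_le_one_left (norm_nonneg _) (norm_radialCutoff_le n x)
  · obtain ⟨N, hN⟩ := exists_nat_ge ‖x‖
    refine tendsto_const_nhds.congr' ?_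
    filter_upwards [eventually_ge_atTop N] with n hn
    have : (N : ℝ) ≤ n := by exact_mod_cast hn
    rw [radialCutoff_eq_one (by linarith)]
    simp

theorem memLp_smooth_mul {a : Rd d → ℝ} (ha : Continuous a) (ha' : HasCompactSupport a)
    {v : Rd d → ℂ} (hv : MemLp v 2) : MemLp (fun x => (a x : ℂ) * v x) 2 := by
  obtain ⟨K, hK⟩ := ha.bounded_above_of_compact_support ha'
  refine hv.of_le_mul (c := K)
    ((Complex.continuous_ofReal.comp ha).aestronglyMeasurable.mul hv.1)
    (Eventually.of_forall fun x => ?_)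
  rw [norm_mul, Complex.norm_real]
  exact mul_le_mul_of_nonneg_right (hK x) (norm_nonneg _)

/-- Integration by parts against a function multiplied by a smooth compactly supported weight. -/
theorem integral_weakPartial_mul {u v : Rd d → ℂ} (hu : MemH1 u) (hv : MemH1 v) {a : Rd d → ℝ}
    (ha : ContDiff ℝ (⊤ : ℕ∞) a) (ha' : HasCompactSupport a) (i : Fin d) :
    ∫ x, (a x : ℂ) * (weakPartial i u x * conj (v x))
      = -(∫ x, (a x : ℂ) * (u x * conj (weakPartial i v x)))
        - ∫ x, (fderiv ℝ a x (EuclideanSpace.single i 1) : ℂ) * (u x * conj (v x)) := by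
  set e : Rd d := EuclideanSpace.single i 1
  have c' := continuous_fderiv_apply ha e
  have s' := hasCompactSupport_fderiv_apply ha' e
  have m1 := memLp_smooth_mul ha.continuous ha' (hv.memLp_weakPartial i)
  have m2 := memLp_smooth_mul c' s' hv.1
  have := (hu.hasWeakDir i).integral_mul_conj ((hv.hasWeakDir i).mul_smooth ha) hu.1
    (hu.memLp_weakPartial i) (memLp_smooth_mul ha.continuous ha' hv.1) (m1.add m2)
  have i1 : Integrable fun x => (a x : ℂ) * (u x * conj (weakPartial i v x)) := by
    refine ((memLp_conj m1).integrable_mul hu.1).congr (Eventually.of_forall fun x => ?_)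
    simp; ring
  have i2 : Integrable fun x => (fderiv ℝ a x e : ℂ) * (u x * conj (v x)) := by
    refine ((memLp_conj m2).integrable_mul hu.1).congr (Eventually.of_forall fun x => ?_)
    simp; ring
  have eL : ∫ x, (a x : ℂ) * (weakPartial i u x * conj (v x))
      = ∫ x, weakPartial i u x * conj ((a x : ℂ) * v x) := by
    refine integral_congr_ae (Eventually.of_forall fun x => ?_)
    simp only [map_mul, Complex.conj_ofReal]; ring
  have eR : ∫ x, u x * conj ((a x : ℂ) * weakPartial i v x + (fderiv ℝ a x e : ℂ) * v x)
      = ∫ x, ((a x : ℂ) * (u x * conj (weakPartial i v x))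
        + (fderiv ℝ a x e : ℂ) * (u x * conj (v x))) := by
    refine integral_congr_ae (Eventually.of_forall fun x => ?_)
    simp only [map_mul, map_add, Complex.conj_ofReal]; ring
  rw [eL, this, eR, integral_add i1 i2, neg_add']

/-- With a radial weight, the angular momentum is symmetric: the gradient of the weight is
orthogonal to the rotation field. -/
theorem integral_radialCutoff_angMom {u v : Rd d → ℂ} (hu : MemH1 u) (hv : MemH1 v) (n : ℕ) :
    ∫ x, (radialCutoff n x : ℂ) * (conj (v x) * angMom u x)
      = ∫ x, (radialCutoff n x : ℂ) * conj (conj (u x) * angMom v x) := by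
  unfold angMom
  split_ifs with h
  swap
  · simp
  set i : Fin d := ⟨0, by omega⟩
  set j : Fin d := ⟨1, by omega⟩
  have coord : ∀ k : Fin d, ContDiff ℝ (⊤ : ℕ∞) fun x : Rd d => x k := fun k =>
    (EuclideanSpace.proj (𝕜 := ℝ) k).contDiff
  have dcoord : ∀ (k l : Fin d) (x : Rd d), k ≠ l →
      fderiv ℝ (fun x : Rd d => x k) x (EuclideanSpace.single l 1) = 0 := fun k l x hkl => by
    rw [show (fun x : Rd d => x k) = EuclideanSpace.proj (𝕜 := ℝ) k from rfl,
      ContinuousLinearMap.fderiv]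
    simp [hkl]
  have hij : i ≠ j := by simp [i, j]
  set χ : Rd d → ℝ := radialCutoff n with hχ
  have cχ : ContDiff ℝ (⊤ : ℕ∞) χ := contDiff_radialCutoff n
  have sχ : HasCompactSupport χ := hasCompactSupport_radialCutoff n
  have ca : ∀ k, ContDiff ℝ (⊤ : ℕ∞) fun x => χ x * x k := fun k => cχ.mul (coord k)
  have sa : ∀ k : Fin d, HasCompactSupport fun x : Rd d => χ x * x k := fun k => sχ.mul_right
  have da : ∀ (k l : Fin d) (x : Rd d), k ≠ l →
      fderiv ℝ (fun x => χ x * x k) x (EuclideanSpace.single l 1)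
        = x k * fderiv ℝ χ x (EuclideanSpace.single l 1) := fun k l x hkl => by
    rw [fderiv_fun_mul (cχ.differentiable (by simp) x) ((coord k).differentiable (by simp) x)]
    simp [dcoord k l x hkl]
  have rad : ∀ x, fderiv ℝ (fun x => χ x * x j) x (EuclideanSpace.single i 1)
      = fderiv ℝ (fun x => χ x * x i) x (EuclideanSpace.single j 1) := fun x => by
    obtain ⟨c, hc⟩ := exists_fderiv_radialCutoff n x
    rw [da j i x hij.symm, da i j x hij, hc, hc]
    ring
  have pj := integral_weakPartial_mul hu hv (ca j) (sa j) i
  have pi := integral_weakPartial_mul hu hv (ca i) (sa i) j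
  -- the two boundary terms, with the derivatives of the weights, are equal and cancel below
  simp only [rad] at pj
  have int : ∀ (k : Fin d) {f g : Rd d → ℂ}, MemLp f 2 → MemLp g 2 →
      Integrable fun x => ((χ x * x k : ℝ) : ℂ) * (f x * conj (g x)) := fun k f g hf hg => by
    refine ((memLp_smooth_mul (ca k).continuous (sa k) hf).integrable_mul (memLp_conj hg)).congr
      (Eventually.of_forall fun x => ?_)
    simp; ring
  have l : ∫ x, (χ x : ℂ) * (conj (v x) * (Complex.I * ((x j : ℂ) * weakPartial i u x
        - (x i : ℂ) * weakPartial j u x)))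
      = Complex.I * ((∫ x, ((χ x * x j : ℝ) : ℂ) * (weakPartial i u x * conj (v x)))
        - ∫ x, ((χ x * x i : ℝ) : ℂ) * (weakPartial j u x * conj (v x))) := by
    rw [← integral_sub (int j (hu.memLp_weakPartial i) hv.1)
      (int i (hu.memLp_weakPartial j) hv.1), ← integral_const_mul]
    refine integral_congr_ae (Eventually.of_forall fun x => ?_)
    push_cast; ring
  have r : ∫ x, (χ x : ℂ) * conj (conj (u x) * (Complex.I * ((x j : ℂ) * weakPartial i v x
        - (x i : ℂ) * weakPartial j v x)))
      = -Complex.I * ((∫ x, ((χ x * x j : ℝ) : ℂ) * (u x * conj (weakPartial i v x)))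
        - ∫ x, ((χ x * x i : ℝ) : ℂ) * (u x * conj (weakPartial j v x))) := by
    rw [← integral_sub (int j hu.1 (hv.memLp_weakPartial i))
      (int i hu.1 (hv.memLp_weakPartial j)), ← integral_const_mul]
    refine integral_congr_ae (Eventually.of_forall fun x => ?_)
    simp only [map_mul, map_sub, Complex.conj_I, Complex.conj_ofReal, Complex.conj_conj]
    push_cast; ring
  rw [l, r, pj, pi]
  ring

section

variable {V : Rd d → ℝ} {Ω θ C : ℝ}

theorem SubcriticalRotation.integral_angMom_symm (hS : SubcriticalRotation V Ω θ C)
    (hV0 : ∀ x, 0 ≤ V x) {u v : Rd d → ℂ} (hu : u ∈ X V) (hv : v ∈ X V) :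
    (Ω : ℂ) * ∫ x, conj (v x) * angMom u x
      = conj ((Ω : ℂ) * ∫ x, conj (u x) * angMom v x) := by
  rw [map_mul, ← integral_conj, Complex.conj_ofReal, ← integral_const_mul, ← integral_const_mul]
  have i1 := hS.integrable hV0 hu hv
  have i2 : Integrable fun x => (Ω : ℂ) * conj (conj (u x) * angMom v x) := by
    refine ((Complex.conjCLE : ℂ →L[ℝ] ℂ).integrable_comp (hS.integrable hV0 hv hu)).congr
      (Eventually.of_forall fun x => ?_)
    simp
  refine tendsto_nhds_unique (tendsto_integral_radialCutoff i1)
    ((tendsto_integral_radialCutoff i2).congr fun n => ?_)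
  have e := congrArg (fun z => (Ω : ℂ) * z) (integral_radialCutoff_angMom hu.1 hv.1 n)
  simp only [← integral_const_mul] at e
  simp only [mul_left_comm _ (Ω : ℂ)]
  exact e.symm

/-! ### The form of the linear operator -/

theorem MemH1.integrable_grad_mul {u v : Rd d → ℂ} (hu : MemH1 u) (hv : MemH1 v) :
    Integrable fun x => ∑ i, weakPartial i u x * conj (weakPartial i v x) :=
  integrable_finsetSum _ fun i _ =>
    (hu.memLp_weakPartial i).integrable_mul (memLp_conj (hv.memLp_weakPartial i))

theorem integrable_potential_mul (hV : Measurable V) (hV0 : ∀ x, 0 ≤ V x) {u v : Rd d → ℂ}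
    (hu : u ∈ X V) (hv : v ∈ X V) : Integrable fun x => (V x : ℂ) * u x * conj (v x) := by
  rw [mem_X_iff hV hV0] at hu hv
  refine (hu.2.integrable_mul (memLp_conj hv.2)).congr (Eventually.of_forall fun x => ?_)
  have : (V x : ℂ) = ((√(V x) : ℝ) : ℂ) * ((√(V x) : ℝ) : ℂ) := by
    rw [← Complex.ofReal_mul, Real.mul_self_sqrt (hV0 x)]
  simp only [Pi.mul_apply, map_mul, Complex.conj_ofReal]
  rw [this]; ring

theorem formR_conj (hS : SubcriticalRotation V Ω θ C) (hV0 : ∀ x, 0 ≤ V x)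
    {u v : Rd d → ℂ} (hu : u ∈ X V) (hv : v ∈ X V) :
    conj (formR V Ω u v) = formR V Ω v u := by
  have e1 : conj (∫ x, ∑ i, weakPartial i u x * conj (weakPartial i v x))
      = ∫ x, ∑ i, weakPartial i v x * conj (weakPartial i u x) := by
    rw [← integral_conj]
    refine integral_congr_ae (Eventually.of_forall fun x => ?_)
    simp only [map_sum, map_mul, Complex.conj_conj]
    exact Finset.sum_congr rfl fun i _ => mul_comm _ _
  have e2 : conj (∫ x, (V x : ℂ) * u x * conj (v x)) = ∫ x, (V x : ℂ) * v x * conj (u x) := by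
    rw [← integral_conj]
    refine integral_congr_ae (Eventually.of_forall fun x => ?_)
    simp only [map_mul, Complex.conj_conj, Complex.conj_ofReal]
    ring
  unfold formR
  rw [map_sub, map_add, map_mul, e1, e2, ← hS.integral_angMom_symm hV0 hv hu]
  simp only [map_div₀, map_one, map_ofNat]

theorem formR_add_left (hS : SubcriticalRotation V Ω θ C) (hV : Measurable V)
    (hV0 : ∀ x, 0 ≤ V x) {u v w : Rd d → ℂ} (hu : u ∈ X V) (hv : v ∈ X V) (hw : w ∈ X V) :
    formR V Ω (u + v) w = formR V Ω u w + formR V Ω v w := by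
  have e1 : ∫ x, ∑ i, weakPartial i (u + v) x * conj (weakPartial i w x)
      = (∫ x, ∑ i, weakPartial i u x * conj (weakPartial i w x))
        + ∫ x, ∑ i, weakPartial i v x * conj (weakPartial i w x) := by
    rw [← integral_add (hu.1.integrable_grad_mul hw.1) (hv.1.integrable_grad_mul hw.1)]
    refine integral_congr_ae ?_
    filter_upwards [ae_all_iff.mpr fun i => weakPartial_add hu.1 hv.1 i] with x hx
    rw [← Finset.sum_add_distrib]
    refine Finset.sum_congr rfl fun i _ => ?_
    rw [hx i, Pi.add_apply, add_mul]
  have e2 : ∫ x, (V x : ℂ) * (u + v) x * conj (w x)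
      = (∫ x, (V x : ℂ) * u x * conj (w x)) + ∫ x, (V x : ℂ) * v x * conj (w x) := by
    rw [← integral_add (integrable_potential_mul hV hV0 hu hw)
      (integrable_potential_mul hV hV0 hv hw)]
    refine integral_congr_ae (Eventually.of_forall fun x => ?_)
    simp only [Pi.add_apply]; ring
  have e3 : (Ω : ℂ) * ∫ x, conj (w x) * angMom (u + v) x
      = ((Ω : ℂ) * ∫ x, conj (w x) * angMom u x) + (Ω : ℂ) * ∫ x, conj (w x) * angMom v x := by
    simp only [← integral_const_mul]
    rw [← integral_add (hS.integrable hV0 hu hw) (hS.integrable hV0 hv hw)]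
    refine integral_congr_ae ?_
    filter_upwards [angMom_add hu.1 hv.1] with x hx
    rw [hx, Pi.add_apply]; ring
  unfold formR
  rw [e1, e2, e3]
  ring

theorem formR_smul_left {u : Rd d → ℂ} (hu : u ∈ X V) (c : ℂ) (w : Rd d → ℂ) :
    formR V Ω (c • u) w = c * formR V Ω u w := by
  have e1 : ∫ x, ∑ i, weakPartial i (c • u) x * conj (weakPartial i w x)
      = c * ∫ x, ∑ i, weakPartial i u x * conj (weakPartial i w x) := by
    rw [← integral_const_mul]
    refine integral_congr_ae ?_
    filter_upwards [ae_all_iff.mpr fun i => weakPartial_const_smul hu.1 c i] with x hx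
    rw [Finset.mul_sum]
    refine Finset.sum_congr rfl fun i _ => ?_
    rw [hx i, Pi.smul_apply, smul_eq_mul, mul_assoc]
  have e2 : ∫ x, (V x : ℂ) * (c • u) x * conj (w x)
      = c * ∫ x, (V x : ℂ) * u x * conj (w x) := by
    rw [← integral_const_mul]
    refine integral_congr_ae (Eventually.of_forall fun x => ?_)
    simp only [Pi.smul_apply, smul_eq_mul]; ring
  have e3 : ∫ x, conj (w x) * angMom (c • u) x = c * ∫ x, conj (w x) * angMom u x := by
    rw [← integral_const_mul]
    refine integral_congr_ae ?_
    filter_upwards [angMom_const_smul hu.1 c] with x hx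
    rw [hx, Pi.smul_apply, smul_eq_mul]; ring
  unfold formR
  rw [e1, e2, e3]
  ring

theorem formR_self_re (u : Rd d → ℂ) : (formR V Ω u u).re = quadR V Ω u := by
  have e : ∀ z : ℂ, z * conj z = ((‖z‖ ^ 2 : ℝ) : ℂ) := fun z => by
    rw [Complex.mul_conj, Complex.normSq_eq_norm_sq]
  have e1 : ∫ x, ∑ i, weakPartial i u x * conj (weakPartial i u x)
      = ((∫ x, ∑ i, ‖weakPartial i u x‖ ^ 2 : ℝ) : ℂ) := by
    rw [← integral_complex_ofReal]
    simp only [e, Complex.ofReal_sum]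
  have e2 : ∫ x, (V x : ℂ) * u x * conj (u x) = ((∫ x, V x * ‖u x‖ ^ 2 : ℝ) : ℂ) := by
    rw [← integral_complex_ofReal]
    simp only [mul_assoc, e, Complex.ofReal_mul]
  unfold formR quadR rotEnergy
  rw [e1, e2]
  simp
  ring

/-! ### Coercivity and boundedness -/

theorem SubcriticalRotation.abs_rotEnergy_le (hS : SubcriticalRotation V Ω θ C)
    (hV0 : ∀ x, 0 ≤ V x) {u : Rd d → ℂ} (hu : u ∈ X V) :
    |rotEnergy Ω u| ≤ θ * (1 / 2 * (∫ x, ∑ i, ‖weakPartial i u x‖ ^ 2)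
      + ((∫ x, V x * ‖u x‖ ^ 2) + C * ∫ x, ‖u x‖ ^ 2)) := by
  have hg := hu.1.integrable_grad.const_mul (1 / 2)
  have hn := hu.1.integrable_norm_sq.const_mul C
  rw [rotEnergy, neg_mul, Complex.neg_re, abs_neg, ← integral_const_mul]
  refine (Complex.abs_re_le_norm _).trans ((norm_integral_le_of_norm_le
    ((hg.add (hu.2.add hn)).const_mul θ)
    (Eventually.of_forall fun x => hS.norm_le hV0 u u x)).trans_eq ?_)
  have e1 := integral_add hg (hu.2.add hn)
  have e2 := integral_add hu.2 hn
  simp only [Pi.add_apply] at e1 e2 ⊢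
  rw [integral_const_mul, e1, e2, integral_const_mul, integral_const_mul]

theorem normX_sq (hV0 : ∀ x, 0 ≤ V x) {u : Rd d → ℂ} (hu : u ∈ X V) :
    normX V u ^ 2 = (∫ x, ∑ i, ‖weakPartial i u x‖ ^ 2) + ((∫ x, ‖u x‖ ^ 2)
      + ∫ x, V x * ‖u x‖ ^ 2) := by
  have h0 : ∀ x, 0 ≤ (∑ i, ‖weakPartial i u x‖ ^ 2) + (1 + V x) * ‖u x‖ ^ 2 := fun x => by
    have := hV0 x
    positivity
  have e1 := integral_add hu.1.integrable_grad (hu.1.integrable_norm_sq.add hu.2)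
  have e2 := integral_add hu.1.integrable_norm_sq hu.2
  simp only [Pi.add_apply] at e1 e2
  rw [normX, Real.sq_sqrt (integral_nonneg h0)]
  simp only [add_mul, one_mul]
  rw [e1, e2]

theorem normL2_sq (u : Rd d → ℂ) : normL2 u ^ 2 = ∫ x, ‖u x‖ ^ 2 :=
  Real.sq_sqrt (integral_nonneg fun _ => sq_nonneg _)

theorem integral_grad_nonneg (u : Rd d → ℂ) : 0 ≤ ∫ x, ∑ i, ‖weakPartial i u x‖ ^ 2 :=
  integral_nonneg fun _ => Finset.sum_nonneg fun _ _ => sq_nonneg _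

theorem integral_potential_nonneg (hV0 : ∀ x, 0 ≤ V x) (u : Rd d → ℂ) :
    0 ≤ ∫ x, V x * ‖u x‖ ^ 2 :=
  integral_nonneg fun x => mul_nonneg (hV0 x) (sq_nonneg _)

/-- Gårding's inequality for the form of `R`. -/
theorem SubcriticalRotation.coercive (hS : SubcriticalRotation V Ω θ C)
    (hV0 : ∀ x, 0 ≤ V x) {u : Rd d → ℂ} (hu : u ∈ X V) :
    (1 - θ) / 2 * normX V u ^ 2 ≤ quadR V Ω u + (1 + C) * normL2 u ^ 2 := by
  have h1 := (abs_le.mp (hS.abs_rotEnergy_le hV0 hu)).1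
  rw [normX_sq hV0 hu, normL2_sq, quadR]
  have hg := integral_grad_nonneg u
  have hp := integral_potential_nonneg hV0 u
  have hn : 0 ≤ ∫ x, ‖u x‖ ^ 2 := integral_nonneg fun _ => sq_nonneg _
  have hθ := hS.theta_nonneg
  have hθ1 := hS.theta_lt_one
  have hC := hS.const_nonneg
  nlinarith [mul_nonneg (sub_nonneg.mpr hθ1.le) hp, mul_nonneg (sub_nonneg.mpr hθ1.le)
    (mul_nonneg hC hn), mul_nonneg hθ hn]

theorem SubcriticalRotation.quadR_le (hS : SubcriticalRotation V Ω θ C)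
    (hV0 : ∀ x, 0 ≤ V x) {u : Rd d → ℂ} (hu : u ∈ X V) :
    quadR V Ω u ≤ (2 + C) * normX V u ^ 2 := by
  have h1 := (abs_le.mp (hS.abs_rotEnergy_le hV0 hu)).2
  rw [normX_sq hV0 hu, quadR]
  have hg := integral_grad_nonneg u
  have hp := integral_potential_nonneg hV0 u
  have hn : 0 ≤ ∫ x, ‖u x‖ ^ 2 := integral_nonneg fun _ => sq_nonneg _
  have hθ1 := sub_nonneg.mpr hS.theta_lt_one.le
  have hC := hS.const_nonneg
  nlinarith [mul_nonneg hθ1 hp, mul_nonneg hθ1 hg, mul_nonneg hθ1 (mul_nonneg hC hn),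
    mul_nonneg hC hp, mul_nonneg hC hg]

end

/-! ### A compactness inequality -/

theorem enorm_add_sq_le (a b : ℂ) : ‖a + b‖ₑ ^ 2 ≤ 2 * (‖a‖ₑ ^ 2 + ‖b‖ₑ ^ 2) := by
  have h : ‖a + b‖₊ ^ 2 ≤ 2 * (‖a‖₊ ^ 2 + ‖b‖₊ ^ 2) :=
    (pow_le_pow_left' (nnnorm_add_le a b) 2).trans add_sq_le
  simp only [enorm_eq_nnnorm]
  exact_mod_cast h

/-- The Cauchy–Schwarz inequality for the integral over a measure space of arbitrary mass. -/
theorem enorm_integral_sq_le {α : Type*} [MeasurableSpace α] {μ : Measure α} {f : α → ℂ}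
    (hf : AEStronglyMeasurable f μ) :
    ‖∫ x, f x ∂μ‖ₑ ^ 2 ≤ μ Set.univ * ∫⁻ x, ‖f x‖ₑ ^ 2 ∂μ := by
  have h1 := enorm_integral_le_lintegral_enorm (μ := μ) f
  rw [← eLpNorm_one_eq_lintegral_enorm] at h1
  have h2 := eLpNorm_le_eLpNorm_mul_rpow_measure_univ (p := 1) (q := 2) (by norm_num) hf
  have h3 : eLpNorm f 2 μ ^ 2 = ∫⁻ x, ‖f x‖ₑ ^ 2 ∂μ := by
    have := eLpNorm_nnreal_pow_eq_lintegral (f := f) (μ := μ) (p := 2) (by norm_num)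
    simpa using this
  calc ‖∫ x, f x ∂μ‖ₑ ^ 2 ≤ (eLpNorm f 2 μ * μ Set.univ ^ ((1 : ℝ) / 2)) ^ 2 := by
        gcongr
        refine h1.trans (h2.trans_eq ?_)
        norm_num
    _ = μ Set.univ * ∫⁻ x, ‖f x‖ₑ ^ 2 ∂μ := by
        rw [mul_pow, h3, ← ENNReal.rpow_natCast, ← ENNReal.rpow_mul, mul_comm]
        norm_num

theorem lintegral_enorm_sq_eq {u : Rd d → ℂ} (hu : MemLp u 2) :
    ∫⁻ x, ‖u x‖ₑ ^ 2 = ENNReal.ofReal (∫ x, ‖u x‖ ^ 2) := by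
  rw [ofReal_integral_eq_lintegral_ofReal ((memLp_two_iff_integrable_sq_norm hu.1).mp hu)
    (Eventually.of_forall fun _ => sq_nonneg _)]
  refine lintegral_congr fun x => ?_
  rw [ENNReal.ofReal_pow (norm_nonneg _), ofReal_norm]

/-- A function is controlled pointwise by its mean over a ball and by the mean size of its
increments. -/
theorem enorm_sq_le_increments_add_mean {w : Rd d → ℂ} (hw : MemLp w 2) {s : ℝ} (hs : 0 < s)
    {x y : Rd d} (hx : x ∈ Metric.ball y s) :
    ‖w x‖ₑ ^ 2 ≤ 2 * ((volume (Metric.ball (0 : Rd d) s))⁻¹ *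
        (∫⁻ h in Metric.ball (0 : Rd d) (2 * s), ‖w (x + h) - w x‖ₑ ^ 2)
      + ((volume (Metric.ball (0 : Rd d) s))⁻¹ * ‖∫ z in Metric.ball y s, w z‖ₑ) ^ 2) := by
  set c := volume (Metric.ball (0 : Rd d) s) with hc
  have c0 : c ≠ 0 := (Metric.measure_ball_pos volume _ hs).ne'
  have ct : c ≠ ⊤ := measure_ball_lt_top.ne
  have cB : volume (Metric.ball y s) = c := Measure.addHaar_ball_center volume y s
  set κ := c.toReal with hκ
  have κ0 : 0 < κ := ENNReal.toReal_pos c0 ct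
  have eκ : ‖(κ⁻¹ : ℂ)‖ₑ = c⁻¹ := by
    rw [← Complex.ofReal_inv, ← ofReal_norm, Complex.norm_real,
      Real.norm_of_nonneg (by positivity), ENNReal.ofReal_inv_of_pos κ0, ENNReal.ofReal_toReal ct]
  have : IsFiniteMeasure (volume.restrict (Metric.ball y s)) :=
    ⟨by rw [Measure.restrict_apply_univ, cB]; exact ct.lt_top⟩
  have wint : IntegrableOn w (Metric.ball y s) := (hw.restrict _).integrable (by norm_num)
  set A : ℂ := ∫ z in Metric.ball y s, (w x - w z) with hA
  have eA : A = κ * w x - ∫ z in Metric.ball y s, w z := by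
    rw [hA, integral_sub (integrable_const _) wint, setIntegral_const,
      Measure.real, cB, Complex.real_smul]
  have ew : w x = (κ⁻¹ : ℂ) * A + (κ⁻¹ : ℂ) * ∫ z in Metric.ball y s, w z := by
    rw [eA]
    have : (κ : ℂ) ≠ 0 := by exact_mod_cast κ0.ne'
    field_simp
    ring
  have hA2 : ‖A‖ₑ ^ 2 ≤ c * ∫⁻ h in Metric.ball (0 : Rd d) (2 * s), ‖w (x + h) - w x‖ₑ ^ 2 := by
    have h1 := enorm_integral_sq_le (μ := volume.restrict (Metric.ball y s))
      (f := fun z => w x - w z) (aestronglyMeasurable_const.sub hw.1.restrict)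
    rw [Measure.restrict_apply_univ, cB] at h1
    refine h1.trans (mul_le_mul' le_rfl ?_)
    rw [← lintegral_indicator Metric.isOpen_ball.measurableSet,
      ← lintegral_indicator Metric.isOpen_ball.measurableSet, ← lintegral_add_left_eq_self _ x]
    refine lintegral_mono fun h => ?_
    by_cases hh : x + h ∈ Metric.ball y s
    · have hh' : h ∈ Metric.ball (0 : Rd d) (2 * s) := by
        rw [mem_ball_zero_iff]
        have := dist_triangle_right (x + h) x y
        rw [dist_eq_norm, add_sub_cancel_left] at this
        rw [Metric.mem_ball] at hx hh
        linarith
      rw [Set.indicator_of_mem hh, Set.indicator_of_mem hh', enorm_sub_rev]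
    · rw [Set.indicator_of_notMem hh]
      exact zero_le
  nth_rewrite 1 [ew]
  refine (enorm_add_sq_le _ _).trans ?_
  rw [enorm_mul, enorm_mul, eκ, mul_pow]
  refine mul_le_mul' le_rfl (add_le_add ?_ le_rfl)
  refine (mul_le_mul' le_rfl hA2).trans_eq ?_
  rw [← mul_assoc, sq, mul_assoc c⁻¹, ENNReal.inv_mul_cancel c0 ct, mul_one]

theorem MemH1.hasWeakDir_vector {u : Rd d → ℂ} (hu : MemH1 u) (h : Rd d) :
    HasWeakDir h u (∑ i, ((h i : ℝ) : ℂ) • weakPartial i u) := by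
  have e : h = ∑ i, h i • EuclideanSpace.single i (1 : ℝ) := by
    ext j
    simp [Finset.sum_apply, Pi.single_apply]
  have := HasWeakDir.sum_dir Finset.univ (hu.1.locallyIntegrable (by norm_num)) fun i _ =>
    (hu.hasWeakDir i).smul_dir (h i)
  rwa [← e] at this

/-- The `L²` modulus of continuity of a function in `H¹`. -/
theorem MemH1.integral_translate_sub_le {u : Rd d → ℂ} (hu : MemH1 u) (h : Rd d) :
    ∫ x, ‖u (x + h) - u x‖ ^ 2 ≤ ‖h‖ ^ 2 * ∫ x, ∑ i, ‖weakPartial i u x‖ ^ 2 := by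
  have hg : MemLp (∑ i, ((h i : ℝ) : ℂ) • weakPartial i u) 2 :=
    memLp_finsetSum' _ fun i _ => (hu.memLp_weakPartial i).const_smul ((h i : ℝ) : ℂ)
  have h1 := (hu.hasWeakDir_vector h).norm_translate_sub_le hu.1 hg
  rw [← MemLp.toLp_sub] at h1
  have h2 := pow_le_pow_left₀ (norm_nonneg _) h1 2
  rw [← integral_norm_sq_eq, ← integral_norm_sq_eq] at h2
  refine h2.trans ?_
  rw [← integral_const_mul]
  refine integral_mono ((memLp_two_iff_integrable_sq_norm hg.1).mp hg)
    (hu.integrable_grad.const_mul _) fun x => ?_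
  simp only [Finset.sum_apply, Pi.smul_apply, smul_eq_mul]
  rw [EuclideanSpace.norm_sq_eq]
  refine (pow_le_pow_left₀ (norm_nonneg _) (norm_sum_le _ _) 2).trans ?_
  simp only [norm_mul, Complex.norm_real]
  exact Finset.sum_mul_sq_le_sq_mul_sq _ _ _

theorem two_mul_ofReal (a : ℝ) : 2 * ENNReal.ofReal a = ENNReal.ofReal (2 * a) := by
  rw [ENNReal.ofReal_mul (by norm_num)]; simp

/-- Friedrichs' inequality: up to a small multiple of the Dirichlet integral, the `L²` norm on a
ball is controlled by finitely many linear functionals. -/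
theorem friedrichs {ε : ℝ} (hε : 0 < ε) (R : ℝ) :
    ∃ (s D : ℝ) (t : Finset (Rd d)), 0 ≤ D ∧ ∀ u : Rd d → ℂ, MemH1 u →
      ∫ x in Metric.ball (0 : Rd d) R, ‖u x‖ ^ 2
        ≤ ε * (∫ x, ∑ i, ‖weakPartial i u x‖ ^ 2)
          + D * ∑ y ∈ t, ‖∫ z in Metric.ball y s, u z‖ ^ 2 := by
  classical
  -- the constant is `2 · (2s)² / s²`, from squaring and from increments of length at most `2s`,
  -- times the ratio `2 ^ d` of the volumes of the balls of radius `2s` and `s`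
  set K : ℝ := 8 * 2 ^ d with hK
  have K0 : 0 < K := by positivity
  set s : ℝ := √(ε / K) with hs_def
  have hs : 0 < s := Real.sqrt_pos.mpr (by positivity)
  have hs2 : K * s ^ 2 = ε := by
    rw [hs_def, Real.sq_sqrt (by positivity)]; field_simp
  obtain ⟨t, -, tfin, tcov⟩ := (isCompact_closedBall (0 : Rd d) R).finite_cover_balls hs
  set c := volume (Metric.ball (0 : Rd d) s) with hc
  have c0 : c ≠ 0 := (Metric.measure_ball_pos volume _ hs).ne'
  have ct : c ≠ ⊤ := measure_ball_lt_top.ne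
  set b := volume (Metric.ball (0 : Rd d) R) with hb
  have bt : b ≠ ⊤ := measure_ball_lt_top.ne
  refine ⟨s, 2 * ((c⁻¹).toReal ^ 2 * b.toReal), tfin.toFinset, by positivity, fun u hu => ?_⟩
  set G := ∫ x, ∑ i, ‖weakPartial i u x‖ ^ 2 with hG
  have G0 : 0 ≤ G := integral_grad_nonneg u
  -- every point of the ball lies in one of finitely many balls of radius `s`
  have pt : ∀ x ∈ Metric.ball (0 : Rd d) R, ‖u x‖ₑ ^ 2 ≤ 2 * (c⁻¹ *
      (∫⁻ h in Metric.ball (0 : Rd d) (2 * s), ‖u (x + h) - u x‖ₑ ^ 2)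
      + ∑ y ∈ tfin.toFinset, (c⁻¹ * ‖∫ z in Metric.ball y s, u z‖ₑ) ^ 2) := fun x hx => by
    obtain ⟨y, hy, hxy⟩ := Set.mem_iUnion₂.mp (tcov (Metric.ball_subset_closedBall hx))
    refine (enorm_sq_le_increments_add_mean hu.1 hs hxy).trans ?_
    gcongr
    exact Finset.single_le_sum
      (f := fun y => (c⁻¹ * ‖∫ z in Metric.ball y s, u z‖ₑ) ^ 2) (fun _ _ => zero_le)
      (tfin.mem_toFinset.mpr hy)
  have meas : AEMeasurable (Function.uncurry fun x h : Rd d => ‖u (x + h) - u x‖ₑ ^ 2)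
      ((volume : Measure (Rd d)).prod
        (volume.restrict (Metric.ball (0 : Rd d) (2 * s)))) := by
    have m1 : AEStronglyMeasurable (fun p : Rd d × Rd d => u (p.1 + p.2))
        ((volume : Measure (Rd d)).prod volume) :=
      hu.1.1.comp_quasiMeasurePreserving (quasiMeasurePreserving_add volume volume)
    have m2 : AEStronglyMeasurable (fun p : Rd d × Rd d => u p.1)
        ((volume : Measure (Rd d)).prod volume) := hu.1.1.comp_fst
    have m3 := ((m1.sub m2).enorm.pow_const 2)
    exact m3.mono_ac (Measure.AbsolutelyContinuous.prod (Measure.AbsolutelyContinuous.rfl)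
      Measure.restrict_le_self.absolutelyContinuous)
  have incr : ∫⁻ x, ∫⁻ h in Metric.ball (0 : Rd d) (2 * s), ‖u (x + h) - u x‖ₑ ^ 2
      ≤ ENNReal.ofReal ((2 * s) ^ 2 * G) * (ENNReal.ofReal (2 ^ d) * c) := by
    rw [lintegral_lintegral_swap meas]
    have vol : volume (Metric.ball (0 : Rd d) (2 * s)) = ENNReal.ofReal (2 ^ d) * c := by
      rw [Measure.addHaar_ball_mul_of_pos volume _ two_pos]; simp [hc]
    rw [← vol, ← setLIntegral_const]
    refine setLIntegral_mono measurable_const fun h hh => ?_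
    have hm : MemLp (fun x => u (x + h) - u x) 2 := (memLp_translate hu.1 h).sub hu.1
    rw [lintegral_enorm_sq_eq hm]
    refine ENNReal.ofReal_le_ofReal ((hu.integral_translate_sub_le h).trans ?_)
    rw [mem_ball_zero_iff] at hh
    gcongr
  have main : ∫⁻ x in Metric.ball (0 : Rd d) R, ‖u x‖ₑ ^ 2
      ≤ ENNReal.ofReal (ε * G) + ENNReal.ofReal (2 * ((c⁻¹).toReal ^ 2 * b.toReal) *
          ∑ y ∈ tfin.toFinset, ‖∫ z in Metric.ball y s, u z‖ ^ 2) := by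
    calc ∫⁻ x in Metric.ball (0 : Rd d) R, ‖u x‖ₑ ^ 2
        ≤ ∫⁻ x in Metric.ball (0 : Rd d) R, 2 * (c⁻¹ *
            (∫⁻ h in Metric.ball (0 : Rd d) (2 * s), ‖u (x + h) - u x‖ₑ ^ 2)
            + ∑ y ∈ tfin.toFinset, (c⁻¹ * ‖∫ z in Metric.ball y s, u z‖ₑ) ^ 2) :=
          setLIntegral_mono' Metric.isOpen_ball.measurableSet pt
      _ = 2 * (c⁻¹ * (∫⁻ x in Metric.ball (0 : Rd d) R,
            ∫⁻ h in Metric.ball (0 : Rd d) (2 * s), ‖u (x + h) - u x‖ₑ ^ 2)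
            + (∑ y ∈ tfin.toFinset, (c⁻¹ * ‖∫ z in Metric.ball y s, u z‖ₑ) ^ 2) * b) := by
          rw [lintegral_const_mul' _ _ (by norm_num), lintegral_add_right _ measurable_const,
            setLIntegral_const, lintegral_const_mul' _ _ (ENNReal.inv_ne_top.mpr c0)]
      _ ≤ 2 * (c⁻¹ * (ENNReal.ofReal ((2 * s) ^ 2 * G) * (ENNReal.ofReal (2 ^ d) * c))
            + (∑ y ∈ tfin.toFinset, (c⁻¹ * ‖∫ z in Metric.ball y s, u z‖ₑ) ^ 2) * b) := by
          gcongr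
          exact (lintegral_mono' Measure.restrict_le_self le_rfl).trans incr
      _ = 2 * (c⁻¹ * (ENNReal.ofReal ((2 * s) ^ 2 * G) * (ENNReal.ofReal (2 ^ d) * c)))
            + 2 * ((∑ y ∈ tfin.toFinset, (c⁻¹ * ‖∫ z in Metric.ball y s, u z‖ₑ) ^ 2) * b) :=
          mul_add _ _ _
      _ = _ := by
          congr 1
          · rw [show c⁻¹ * (ENNReal.ofReal ((2 * s) ^ 2 * G) * (ENNReal.ofReal (2 ^ d) * c))
                = (c⁻¹ * c) * (ENNReal.ofReal ((2 * s) ^ 2 * G) * ENNReal.ofReal (2 ^ d)) by ring,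
              ENNReal.inv_mul_cancel c0 ct, one_mul, ← ENNReal.ofReal_mul (by positivity),
              two_mul_ofReal, ← hs2, hK]
            congr 1; ring
          · have e : ∀ y : Rd d, (c⁻¹ * ‖∫ z in Metric.ball y s, u z‖ₑ) ^ 2
                = ENNReal.ofReal ((c⁻¹).toReal ^ 2 * ‖∫ z in Metric.ball y s, u z‖ ^ 2) := by
              intro y
              rw [mul_pow, ENNReal.ofReal_mul (by positivity), ENNReal.ofReal_pow (by positivity),
                ENNReal.ofReal_pow (by positivity), ofReal_norm,
                ENNReal.ofReal_toReal (ENNReal.inv_ne_top.mpr c0)]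
            simp only [e]
            rw [← ENNReal.ofReal_sum_of_nonneg (fun _ _ => by positivity),
              ← ENNReal.ofReal_toReal bt, ← ENNReal.ofReal_mul
                (Finset.sum_nonneg fun _ _ => by positivity),
              two_mul_ofReal, ← Finset.mul_sum,
              ENNReal.toReal_ofReal (by positivity)]
            congr 1; ring
  have e : ENNReal.ofReal (∫ x in Metric.ball (0 : Rd d) R, ‖u x‖ ^ 2)
      = ∫⁻ x in Metric.ball (0 : Rd d) R, ‖u x‖ₑ ^ 2 := by
    rw [ofReal_integral_eq_lintegral_ofReal hu.integrable_norm_sq.restrict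
      (Eventually.of_forall fun _ => sq_nonneg _)]
    refine lintegral_congr fun x => ?_
    rw [ENNReal.ofReal_pow (norm_nonneg _), ofReal_norm]
  rw [← e, ← ENNReal.ofReal_add (by positivity) (by positivity)] at main
  exact (ENNReal.ofReal_le_ofReal_iff (by positivity)).mp main

/-! ### Norms on the energy space -/

theorem normL2_nonneg (u : Rd d → ℂ) : 0 ≤ normL2 u := Real.sqrt_nonneg _

theorem normX_nonneg (V : Rd d → ℝ) (u : Rd d → ℂ) : 0 ≤ normX V u := Real.sqrt_nonneg _

theorem normL2_congr {u v : Rd d → ℂ} (h : u =ᵐ[volume] v) : normL2 u = normL2 v := by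
  have : ∫ x, ‖u x‖ ^ 2 = ∫ x, ‖v x‖ ^ 2 :=
    integral_congr_ae (h.mono fun x hx => by simp only [hx])
  rw [normL2, normL2, this]

theorem normL2_sub_eq {u v : Rd d → ℂ} (hu : MemLp u 2 volume) (hv : MemLp v 2 volume) :
    normL2 (u - v) = ‖hu.toLp u - hv.toLp v‖ := by
  rw [← MemLp.toLp_sub, ← normL2_eq]

theorem weakPartial_sub {u v : Rd d → ℂ} (hu : MemH1 u) (hv : MemH1 v) (i : Fin d) :
    weakPartial i (u - v) =ᵐ[volume] weakPartial i u - weakPartial i v := by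
  have h := weakPartial_add hu (hv.const_smul (-1)) i
  rw [neg_one_smul, ← sub_eq_add_neg] at h
  filter_upwards [h, weakPartial_const_smul hv (-1) i] with x h1 h2
  rw [h1, Pi.add_apply, ← neg_one_smul ℂ v, h2]
  simp [sub_eq_add_neg]

section

variable {V : Rd d → ℝ}

/-- `‖u‖_X²` as a sum of squares of `L²` norms. -/
theorem normX_sq_eq_sum (hV0 : ∀ x, 0 ≤ V x) {u : Rd d → ℂ} (hu : u ∈ X V) :
    normX V u ^ 2 = (∑ i, normL2 (weakPartial i u) ^ 2)
      + (normL2 u ^ 2 + normL2 (fun x => ((√(V x) : ℝ) : ℂ) * u x) ^ 2) := by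
  rw [normX_sq hV0 hu, integral_finsetSum _ fun i _ =>
    (memLp_two_iff_integrable_sq_norm (hu.1.memLp_weakPartial i).1).mp (hu.1.memLp_weakPartial i)]
  simp only [normL2_sq, norm_sqrt_mul_sq (hV0 _)]

theorem normL2_weakPartial_le (hV0 : ∀ x, 0 ≤ V x) {u : Rd d → ℂ} (hu : u ∈ X V) (i : Fin d) :
    normL2 (weakPartial i u) ≤ normX V u := by
  refine le_of_sq_le_sq ?_ (normX_nonneg _ _)
  rw [normX_sq_eq_sum hV0 hu]
  have := Finset.single_le_sum (f := fun i => normL2 (weakPartial i u) ^ 2)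
    (fun _ _ => sq_nonneg _) (Finset.mem_univ i)
  nlinarith [sq_nonneg (normL2 u), sq_nonneg (normL2 (fun x => ((√(V x) : ℝ) : ℂ) * u x))]

theorem normL2_le_normX (hV0 : ∀ x, 0 ≤ V x) {u : Rd d → ℂ} (hu : u ∈ X V) :
    normL2 u ≤ normX V u := by
  refine le_of_sq_le_sq ?_ (normX_nonneg _ _)
  rw [normX_sq_eq_sum hV0 hu]
  have : 0 ≤ ∑ i, normL2 (weakPartial i u) ^ 2 := Finset.sum_nonneg fun _ _ => sq_nonneg _
  nlinarith [sq_nonneg (normL2 (fun x => ((√(V x) : ℝ) : ℂ) * u x))]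

theorem normL2_sqrt_mul_le_normX (hV0 : ∀ x, 0 ≤ V x) {u : Rd d → ℂ} (hu : u ∈ X V) :
    normL2 (fun x => ((√(V x) : ℝ) : ℂ) * u x) ≤ normX V u := by
  refine le_of_sq_le_sq ?_ (normX_nonneg _ _)
  rw [normX_sq_eq_sum hV0 hu]
  have : 0 ≤ ∑ i, normL2 (weakPartial i u) ^ 2 := Finset.sum_nonneg fun _ _ => sq_nonneg _
  nlinarith [sq_nonneg (normL2 u)]

theorem normL2_sub_sq_le {u v : Rd d → ℂ} (hu : MemLp u 2) (hv : MemLp v 2) :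
    normL2 (u - v) ^ 2 ≤ 2 * (normL2 u ^ 2 + normL2 v ^ 2) := by
  rw [normL2_sub_eq hu hv, normL2_eq hu, normL2_eq hv]
  exact (pow_le_pow_left₀ (norm_nonneg _) (norm_sub_le _ _) 2).trans add_sq_le

theorem normX_sub_sq_le (hV : Measurable V) (hV0 : ∀ x, 0 ≤ V x) {u v : Rd d → ℂ}
    (hu : u ∈ X V) (hv : v ∈ X V) :
    normX V (u - v) ^ 2 ≤ 2 * (normX V u ^ 2 + normX V v ^ 2) := by
  have e : (fun x => ((√(V x) : ℝ) : ℂ) * (u - v) x)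
      = (fun x => ((√(V x) : ℝ) : ℂ) * u x) - fun x => ((√(V x) : ℝ) : ℂ) * v x := by
    funext x; simp only [Pi.sub_apply]; ring
  rw [normX_sq_eq_sum hV0 (X_sub hV hV0 hu hv), normX_sq_eq_sum hV0 hu, normX_sq_eq_sum hV0 hv, e]
  have h1 := normL2_sub_sq_le hu.1.1 hv.1.1
  have h2 := normL2_sub_sq_le ((mem_X_iff hV hV0).mp hu).2 ((mem_X_iff hV hV0).mp hv).2
  have h3 : ∑ i, normL2 (weakPartial i (u - v)) ^ 2
      ≤ ∑ i, 2 * (normL2 (weakPartial i u) ^ 2 + normL2 (weakPartial i v) ^ 2) :=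
    Finset.sum_le_sum fun i _ => by
      rw [normL2_congr (weakPartial_sub hu.1 hv.1 i)]
      exact normL2_sub_sq_le (hu.1.memLp_weakPartial i) (hv.1.memLp_weakPartial i)
  rw [← Finset.mul_sum, Finset.sum_add_distrib] at h3
  linarith

/-! ### Compactness of the embedding of the energy space into `L²` -/

/-- Weak sequential compactness of balls in `L²`, by the Banach–Alaoglu theorem. -/
theorem exists_weakly_convergent_subseq {U : ℕ → Lp ℂ 2 (volume : Measure (Rd d))} {M : ℝ}
    (hU : ∀ n, ‖U n‖ ≤ M) : ∃ φ : ℕ → ℕ, StrictMono φ ∧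
      ∀ Z, ∃ l : ℂ, Tendsto (fun n => inner ℂ (U (φ n)) Z) atTop (𝓝 l) := by
  have : Fact ((2 : ENNReal) ≠ ⊤) := ⟨by simp⟩
  have hc := WeakDual.isSeqCompact_closedBall ℂ (Lp ℂ 2 (volume : Measure (Rd d))) 0 M
  obtain ⟨a, -, φ, hφ, ht⟩ := hc (x := fun n => StrongDual.toWeakDual
    (InnerProductSpace.toDual ℂ (Lp ℂ 2 (volume : Measure (Rd d))) (U n))) fun n => by
      simpa using hU n
  refine ⟨φ, hφ, fun Z => ⟨a Z, ?_⟩⟩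
  exact ((WeakDual.eval_continuous Z).tendsto a).comp ht

/-- The compactness inequality on the whole space: the confining potential controls the mass far
from the origin. -/
theorem normL2_sq_le_small_add_functionals (hV0 : ∀ x, 0 ≤ V x)
    (hVconf : Tendsto V (cocompact (Rd d)) atTop) {ε : ℝ} (hε : 0 < ε) :
    ∃ (s D : ℝ) (t : Finset (Rd d)), 0 ≤ D ∧ ∀ u ∈ X V,
      normL2 u ^ 2 ≤ ε * normX V u ^ 2 + D * ∑ y ∈ t, ‖∫ z in Metric.ball y s, u z‖ ^ 2 := by
  obtain ⟨R, hR⟩ := (Metric.hasBasis_cobounded_compl_ball (0 : Rd d)).eventually_iff.mp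
    (by rw [Metric.cobounded_eq_cocompact]; exact hVconf.eventually_ge_atTop ε⁻¹)
  obtain ⟨s, D, t, hD, h⟩ := friedrichs hε R
  refine ⟨s, D, t, hD, fun u hu => ?_⟩
  have h1 := h u hu.1
  have h2 : ∫ x in (Metric.ball (0 : Rd d) R)ᶜ, ‖u x‖ ^ 2 ≤ ε * ∫ x, V x * ‖u x‖ ^ 2 := by
    rw [← integral_const_mul]
    refine (setIntegral_mono_on hu.1.integrable_norm_sq.integrableOn
      (hu.2.const_mul ε).integrableOn Metric.isOpen_ball.measurableSet.compl fun x hx => ?_).trans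
      (setIntegral_le_integral (hu.2.const_mul ε) (Eventually.of_forall fun x =>
        mul_nonneg hε.le (mul_nonneg (hV0 x) (sq_nonneg _))))
    have h3 : 1 ≤ ε * V x := by
      have := mul_le_mul_of_nonneg_left (hR.2 hx) hε.le
      rwa [mul_inv_cancel₀ hε.ne'] at this
    rw [← mul_assoc]
    exact le_mul_of_one_le_left (sq_nonneg _) h3
  rw [normL2_sq, ← integral_add_compl Metric.isOpen_ball.measurableSet hu.1.integrable_norm_sq,
    normX_sq hV0 hu]
  have h4 : 0 ≤ ε * ∫ x, ‖u x‖ ^ 2 :=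
    mul_nonneg hε.le (integral_nonneg fun _ => sq_nonneg _)
  linarith

theorem setIntegral_ball_eq_inner {u : Rd d → ℂ} (hu : MemLp u 2) (y : Rd d) (s : ℝ) :
    ∫ z in Metric.ball y s, u z = inner ℂ (indicatorConstLp 2
      (Metric.isOpen_ball (x := y) (ε := s)).measurableSet measure_ball_lt_top.ne (1 : ℂ))
      (hu.toLp u) := by
  rw [L2.inner_indicatorConstLp_one]
  exact integral_congr_ae (ae_restrict_of_ae (hu.coeFn_toLp.mono fun x hx => hx.symm))

/-- Rellich's theorem: a sequence bounded in the energy space has a subsequence which is Cauchy in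
`L²`. -/
theorem exists_cauchy_subseq_normL2 (hV : Measurable V) (hV0 : ∀ x, 0 ≤ V x)
    (hVconf : Tendsto V (cocompact (Rd d)) atTop) {u : ℕ → Rd d → ℂ} (hu : ∀ n, u n ∈ X V)
    {M : ℝ} (hM : ∀ n, normX V (u n) ≤ M) :
    ∃ φ : ℕ → ℕ, StrictMono φ ∧ ∀ ε > 0, ∃ N, ∀ n ≥ N, ∀ m ≥ N,
      normL2 (u (φ n) - u (φ m)) < ε := by
  obtain ⟨φ, hφ, hw⟩ := exists_weakly_convergent_subseq (U := fun n => (hu n).1.1.toLp (u n))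
    (M := M) fun n => by
      rw [← normL2_eq]; exact (normL2_le_normX hV0 (hu n)).trans (hM n)
  refine ⟨φ, hφ, fun ε hε => ?_⟩
  have hM0 : 0 ≤ M := (normX_nonneg _ _).trans (hM 0)
  obtain ⟨s, D, t, hD, h⟩ := normL2_sq_le_small_add_functionals hV0 hVconf
    (ε := ε ^ 2 / (2 * (4 * M ^ 2 + 1))) (by positivity)
  -- the finitely many functionals converge along the subsequence
  have hsum : Tendsto (fun p : ℕ × ℕ => D * ∑ y ∈ t,
      ‖(∫ z in Metric.ball y s, u (φ p.1) z) - ∫ z in Metric.ball y s, u (φ p.2) z‖ ^ 2)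
      (atTop ×ˢ atTop) (𝓝 (D * ∑ y ∈ t, 0)) := by
    refine (tendsto_finsetSum _ fun y _ => ?_).const_mul D
    obtain ⟨l, hl⟩ := hw (indicatorConstLp 2
      (Metric.isOpen_ball (x := y) (ε := s)).measurableSet measure_ball_lt_top.ne (1 : ℂ))
    have hl' : Tendsto (fun n => ∫ z in Metric.ball y s, u (φ n) z) atTop (𝓝 (conj l)) := by
      refine ((Complex.continuous_conj.tendsto l).comp hl).congr fun n => ?_
      rw [setIntegral_ball_eq_inner (hu (φ n)).1.1, Function.comp, inner_conj_symm]
    have := ((hl'.comp tendsto_fst).sub (hl'.comp tendsto_snd)).norm.pow 2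
    simpa using this
  rw [Finset.sum_const_zero, mul_zero, prod_atTop_atTop_eq] at hsum
  obtain ⟨⟨N1, N2⟩, hN⟩ := eventually_atTop.mp
    (hsum.eventually_lt_const (show (0 : ℝ) < ε ^ 2 / 2 by positivity))
  refine ⟨max N1 N2, fun n hn m hm => ?_⟩
  have h1 := hN (n, m) ⟨(le_max_left _ _).trans hn, (le_max_right _ _).trans hm⟩
  have h2 := h _ (X_sub hV hV0 (hu (φ n)) (hu (φ m)))
  have h3 := normX_sub_sq_le hV hV0 (hu (φ n)) (hu (φ m))
  have b : ∀ n, normX V (u n) ^ 2 ≤ M ^ 2 := fun n =>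
    pow_le_pow_left₀ (normX_nonneg _ _) (hM n) 2
  have h4 : ε ^ 2 / (2 * (4 * M ^ 2 + 1)) * normX V (u (φ n) - u (φ m)) ^ 2 ≤ ε ^ 2 / 2 := by
    calc _ ≤ ε ^ 2 / (2 * (4 * M ^ 2 + 1)) * (4 * M ^ 2 + 1) := by
          gcongr
          linarith [b (φ n), b (φ m)]
      _ = ε ^ 2 / 2 := by field_simp
  have e : ∀ y ∈ t, ‖∫ z in Metric.ball y s, (u (φ n) - u (φ m)) z‖ ^ 2
      = ‖(∫ z in Metric.ball y s, u (φ n) z) - ∫ z in Metric.ball y s, u (φ m) z‖ ^ 2 := by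
    intro y _
    rw [setIntegral_ball_eq_inner ((hu (φ n)).1.1.sub (hu (φ m)).1.1),
      setIntegral_ball_eq_inner (hu (φ n)).1.1, setIntegral_ball_eq_inner (hu (φ m)).1.1,
      MemLp.toLp_sub, inner_sub_right]
  rw [Finset.sum_congr rfl e] at h2
  refine lt_of_pow_lt_pow_left₀ 2 hε.le ?_
  linarith

/-! ### Completeness of the energy space -/

/-- Weak differentiation is a closed operator in `L²`. -/
theorem hasWeakDir_of_tendsto {h : Rd d} {u g : ℕ → Rd d → ℂ} (hu : ∀ n, MemLp (u n) 2)
    (hg : ∀ n, MemLp (g n) 2) (H : ∀ n, HasWeakDir h (u n) (g n))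
    {U G : Lp ℂ 2 (volume : Measure (Rd d))}
    (tu : Tendsto (fun n => (hu n).toLp (u n)) atTop (𝓝 U))
    (tg : Tendsto (fun n => (hg n).toLp (g n)) atTop (𝓝 G)) : HasWeakDir h U G := by
  refine ⟨(Lp.memLp U).locallyIntegrable (by norm_num),
    (Lp.memLp G).locallyIntegrable (by norm_num), fun η h1 h2 => ?_⟩
  have pairing : ∀ {a : Rd d → ℝ} (_ : Continuous a) (_ : HasCompactSupport a),
      ∃ Z : Lp ℂ 2 (volume : Measure (Rd d)), ∀ (f : Rd d → ℂ) (hf : MemLp f 2),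
        ∫ x, a x • f x = inner ℂ Z (hf.toLp f) := fun {a} c s => by
    have hm : MemLp (fun x => (a x : ℂ)) 2 :=
      (Complex.continuous_ofReal.comp c).memLp_of_hasCompactSupport
        (s.comp_left (g := Complex.ofReal) rfl)
    refine ⟨hm.toLp _, fun f hf => ?_⟩
    rw [inner_toLp hf hm]
    refine integral_congr_ae (Eventually.of_forall fun x => ?_)
    simp [mul_comm]
  obtain ⟨Z1, hZ1⟩ := pairing (continuous_fderiv_apply h1 h) (hasCompactSupport_fderiv_apply h2 h)
  obtain ⟨Z2, hZ2⟩ := pairing h1.continuous h2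
  rw [hZ1 U (Lp.memLp U), hZ2 G (Lp.memLp G), Lp.toLp_coeFn, Lp.toLp_coeFn]
  have l1 : Tendsto (fun n => inner ℂ Z1 ((hu n).toLp (u n))) atTop (𝓝 (inner ℂ Z1 U)) :=
    tendsto_const_nhds.inner tu
  have l2 : Tendsto (fun n => inner ℂ Z2 ((hg n).toLp (g n))) atTop (𝓝 (inner ℂ Z2 G)) :=
    tendsto_const_nhds.inner tg
  refine tendsto_nhds_unique l1 (l2.neg.congr fun n => ?_)
  rw [← hZ1, ← hZ2]
  exact ((H n).2.2 η h1 h2).symm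

/-- Multiplication by a function is a closed operator in `L²`. -/
theorem ae_eq_mul_of_tendsto {a : Rd d → ℂ} {u : ℕ → Rd d → ℂ} (hu : ∀ n, MemLp (u n) 2)
    (hw : ∀ n, MemLp (fun x => a x * u n x) 2) {U W : Lp ℂ 2 (volume : Measure (Rd d))}
    (tu : Tendsto (fun n => (hu n).toLp (u n)) atTop (𝓝 U))
    (tw : Tendsto (fun n => (hw n).toLp _) atTop (𝓝 W)) : W =ᵐ[volume] fun x => a x * U x := by
  obtain ⟨ns, hns, h1⟩ := (tendstoInMeasure_of_tendsto_Lp tu).exists_seq_tendsto_ae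
  obtain ⟨ms, hms, h2⟩ := (tendstoInMeasure_of_tendsto_Lp
    (tw.comp hns.tendsto_atTop)).exists_seq_tendsto_ae
  filter_upwards [h1, h2, ae_all_iff.mpr fun n => (hu n).coeFn_toLp,
    ae_all_iff.mpr fun n => (hw n).coeFn_toLp] with x h1 h2 e1 e2
  simp only [e1, e2, Function.comp] at h1 h2
  exact tendsto_nhds_unique h2 ((h1.comp hms.tendsto_atTop).const_mul (a x))

theorem exists_tendsto_toLp {f : ℕ → Rd d → ℂ} (hf : ∀ n, MemLp (f n) 2) {b : ℕ → ℕ → ℝ}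
    (hfb : ∀ n m, normL2 (f n - f m) ≤ b n m)
    (hb : ∀ ε > 0, ∃ N, ∀ n ≥ N, ∀ m ≥ N, b n m < ε) :
    ∃ F, Tendsto (fun n => (hf n).toLp (f n)) atTop (𝓝 F) := by
  refine cauchySeq_tendsto_of_complete (Metric.cauchySeq_iff.mpr fun ε hε => ?_)
  obtain ⟨N, hN⟩ := hb ε hε
  refine ⟨N, fun n hn m hm => ?_⟩
  rw [dist_eq_norm, ← normL2_sub_eq (hf n) (hf m)]
  exact (hfb n m).trans_lt (hN n hn m hm)

/-- The energy space is complete. -/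
theorem exists_tendsto_normX (hV : Measurable V) (hV0 : ∀ x, 0 ≤ V x) {u : ℕ → Rd d → ℂ}
    (hu : ∀ n, u n ∈ X V)
    (hc : ∀ ε > 0, ∃ N, ∀ n ≥ N, ∀ m ≥ N, normX V (u n - u m) < ε) :
    ∃ v ∈ X V, Tendsto (fun n => normX V (u n - v)) atTop (𝓝 0) := by
  have hs : ∀ n, MemLp (fun x => ((√(V x) : ℝ) : ℂ) * u n x) 2 := fun n =>
    ((mem_X_iff hV hV0).mp (hu n)).2
  have subX := fun n m => X_sub hV hV0 (hu n) (hu m)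
  have esub : ∀ f g : Rd d → ℂ, (fun x => ((√(V x) : ℝ) : ℂ) * f x)
      - (fun x => ((√(V x) : ℝ) : ℂ) * g x) = fun x => ((√(V x) : ℝ) : ℂ) * (f - g) x :=
    fun f g => by funext x; simp only [Pi.sub_apply]; ring
  obtain ⟨U, tU⟩ := exists_tendsto_toLp (fun n => (hu n).1.1)
    (fun n m => normL2_le_normX hV0 (subX n m)) hc
  obtain ⟨W, tW⟩ := exists_tendsto_toLp hs (b := fun n m => normX V (u n - u m))
    (fun n m => by rw [esub]; exact normL2_sqrt_mul_le_normX hV0 (subX n m)) hc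
  have hG : ∀ i, ∃ F, Tendsto (fun n => ((hu n).1.memLp_weakPartial i).toLp _) atTop (𝓝 F) :=
    fun i => exists_tendsto_toLp (fun n => (hu n).1.memLp_weakPartial i)
      (b := fun n m => normX V (u n - u m))
      (fun n m => by
        rw [← normL2_congr (weakPartial_sub (hu n).1 (hu m).1 i)]
        exact normL2_weakPartial_le hV0 (subX n m) i) hc
  choose G tG using hG
  have hW : W =ᵐ[volume] fun x => ((√(V x) : ℝ) : ℂ) * U x :=
    ae_eq_mul_of_tendsto (fun n => (hu n).1.1) hs tU tW
  have hGw : ∀ i, HasWeakDir (EuclideanSpace.single i 1) U (G i) := fun i =>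
    hasWeakDir_of_tendsto (fun n => (hu n).1.1) (fun n => (hu n).1.memLp_weakPartial i)
      (fun n => (hu n).1.hasWeakDir i) tU (tG i)
  have UX : (U : Rd d → ℂ) ∈ X V := (mem_X_iff hV hV0).mpr
    ⟨⟨Lp.memLp U, fun i => ⟨G i, hGw i, Lp.memLp (G i)⟩⟩,
      (memLp_congr_ae hW).mp (Lp.memLp W)⟩
  refine ⟨U, UX, ?_⟩
  have conv : ∀ {f : ℕ → Rd d → ℂ} (hf : ∀ n, MemLp (f n) 2)
      {F : Lp ℂ 2 (volume : Measure (Rd d))},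
      Tendsto (fun n => (hf n).toLp (f n)) atTop (𝓝 F) →
      Tendsto (fun n => normL2 (f n - (F : Rd d → ℂ)) ^ 2) atTop (𝓝 0) := fun hf F ht => by
    have h1 := (ht.sub_const F).norm.pow 2
    rw [sub_self, norm_zero, zero_pow two_ne_zero] at h1
    refine h1.congr fun n => ?_
    rw [normL2_sub_eq (hf n) (Lp.memLp F), Lp.toLp_coeFn]
  have total := (tendsto_finsetSum Finset.univ fun i _ =>
    conv (fun n => (hu n).1.memLp_weakPartial i) (tG i)).add
    ((conv (fun n => (hu n).1.1) tU).add (conv hs tW))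
  rw [Finset.sum_const_zero, add_zero, add_zero] at total
  have sq : Tendsto (fun n => normX V (u n - (U : Rd d → ℂ)) ^ 2) atTop (𝓝 0) := by
    refine total.congr fun n => ?_
    rw [normX_sq_eq_sum hV0 (X_sub hV hV0 (hu n) UX), ← esub]
    congr 1
    · refine Finset.sum_congr rfl fun i _ => ?_
      rw [normL2_congr (weakPartial_sub (hu n).1 UX.1 i)]
      congr 1
      refine normL2_congr ?_
      filter_upwards [weakPartial_ae_eq (hGw i)] with x hx
      rw [Pi.sub_apply, Pi.sub_apply, hx]
    · congr 2
      refine normL2_congr ?_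
      filter_upwards [hW] with x hx
      rw [Pi.sub_apply, Pi.sub_apply, hx]
  have := sq.sqrt
  simpa [Real.sqrt_sq (normX_nonneg _ _)] using this

end

/-! ### The form shifted by the lowest eigenvalue -/

/-- The sesquilinear form of `R - λ₀(Ω)`. -/
def shiftedForm (V : Rd d → ℝ) (Ω : ℝ) (u v : Rd d → ℂ) : ℂ :=
  formR V Ω u v - (lambda0 V Ω : ℂ) * ∫ x, u x * conj (v x)

/-- The quadratic form of `R - λ₀(Ω)`; it is nonnegative on the energy space. -/
def shiftedQuad (V : Rd d → ℝ) (Ω : ℝ) (u : Rd d → ℂ) : ℝ :=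
  quadR V Ω u - lambda0 V Ω * normL2 u ^ 2

section

variable {V : Rd d → ℝ} {Ω θ C : ℝ}

theorem integral_mul_conj_self (u : Rd d → ℂ) :
    ∫ x, u x * conj (u x) = ((normL2 u ^ 2 : ℝ) : ℂ) := by
  rw [normL2_sq, ← integral_complex_ofReal]
  refine integral_congr_ae (Eventually.of_forall fun x => ?_)
  change u x * conj (u x) = ((‖u x‖ ^ 2 : ℝ) : ℂ)
  rw [Complex.mul_conj, Complex.normSq_eq_norm_sq]

theorem shiftedForm_self_re (u : Rd d → ℂ) :
    (shiftedForm V Ω u u).re = shiftedQuad V Ω u := by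
  rw [shiftedForm, shiftedQuad, integral_mul_conj_self, ← Complex.ofReal_mul, Complex.sub_re,
    formR_self_re, Complex.ofReal_re]

theorem shiftedForm_conj (hS : SubcriticalRotation V Ω θ C) (hV0 : ∀ x, 0 ≤ V x)
    {u v : Rd d → ℂ} (hu : u ∈ X V) (hv : v ∈ X V) :
    conj (shiftedForm V Ω u v) = shiftedForm V Ω v u := by
  rw [shiftedForm, shiftedForm, map_sub, map_mul, formR_conj hS hV0 hu hv, Complex.conj_ofReal,
    ← integral_conj]
  simp only [map_mul, Complex.conj_conj, mul_comm]

theorem shiftedForm_add_left (hS : SubcriticalRotation V Ω θ C) (hV : Measurable V)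
    (hV0 : ∀ x, 0 ≤ V x) {u v w : Rd d → ℂ} (hu : u ∈ X V) (hv : v ∈ X V) (hw : w ∈ X V) :
    shiftedForm V Ω (u + v) w = shiftedForm V Ω u w + shiftedForm V Ω v w := by
  have i1 := hu.1.1.integrable_mul (memLp_conj hw.1.1)
  have i2 := hv.1.1.integrable_mul (memLp_conj hw.1.1)
  have e := integral_add i1 i2
  simp only [Pi.mul_apply] at e
  simp only [shiftedForm, formR_add_left hS hV hV0 hu hv hw, Pi.add_apply, add_mul]
  rw [e]
  ring

theorem shiftedForm_smul_left {u : Rd d → ℂ} (hu : u ∈ X V) (c : ℂ) (w : Rd d → ℂ) :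
    shiftedForm V Ω (c • u) w = c * shiftedForm V Ω u w := by
  simp only [shiftedForm, formR_smul_left hu, Pi.smul_apply, smul_eq_mul, mul_assoc]
  rw [integral_const_mul]
  ring

theorem shiftedQuad_add (hS : SubcriticalRotation V Ω θ C) (hV : Measurable V)
    (hV0 : ∀ x, 0 ≤ V x) {u v : Rd d → ℂ} (hu : u ∈ X V) (hv : v ∈ X V) :
    shiftedQuad V Ω (u + v)
      = shiftedQuad V Ω u + 2 * (shiftedForm V Ω u v).re + shiftedQuad V Ω v := by
  have huv := X_add hV hV0 hu hv
  rw [← shiftedForm_self_re, ← shiftedForm_self_re, ← shiftedForm_self_re,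
    shiftedForm_add_left hS hV hV0 hu hv huv, ← shiftedForm_conj hS hV0 huv hu,
    ← shiftedForm_conj hS hV0 huv hv, shiftedForm_add_left hS hV hV0 hu hv hu,
    shiftedForm_add_left hS hV hV0 hu hv hv, ← shiftedForm_conj hS hV0 hu hv]
  simp only [map_add, Complex.conj_conj, Complex.add_re, Complex.conj_re]
  ring

theorem shiftedQuad_smul (hS : SubcriticalRotation V Ω θ C) (hV : Measurable V)
    (hV0 : ∀ x, 0 ≤ V x) {u : Rd d → ℂ} (hu : u ∈ X V) (c : ℂ) :
    shiftedQuad V Ω (c • u) = ‖c‖ ^ 2 * shiftedQuad V Ω u := by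
  have hc := X_smul hV hV0 hu c
  rw [← shiftedForm_self_re, ← shiftedForm_self_re, shiftedForm_smul_left hu,
    ← shiftedForm_conj hS hV0 hc hu, shiftedForm_smul_left hu, map_mul,
    shiftedForm_conj hS hV0 hu hu, ← mul_assoc, Complex.mul_conj, Complex.re_ofReal_mul,
    Complex.normSq_eq_norm_sq]

theorem normL2_smul (c : ℂ) (u : Rd d → ℂ) : normL2 (c • u) = ‖c‖ * normL2 u := by
  refine (pow_left_inj₀ (normL2_nonneg _) (mul_nonneg (norm_nonneg _) (normL2_nonneg _))
    two_ne_zero).mp ?_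
  rw [mul_pow, normL2_sq, normL2_sq, ← integral_const_mul]
  simp only [Pi.smul_apply, smul_eq_mul, norm_mul, mul_pow]

theorem ae_eq_zero_of_normL2_eq_zero {u : Rd d → ℂ} (hu : MemLp u 2) (h : normL2 u = 0) :
    u =ᵐ[volume] 0 := by
  rw [normL2_eq hu, norm_eq_zero, Lp.eq_zero_iff_ae_eq_zero] at h
  exact hu.coeFn_toLp.symm.trans h

theorem shiftedQuad_nonneg (hS : SubcriticalRotation V Ω θ C) (hV0 : ∀ x, 0 ≤ V x)
    {u : Rd d → ℂ} (hu : u ∈ X V) : 0 ≤ shiftedQuad V Ω u := by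
  have coer : ∀ v ∈ X V, 0 ≤ quadR V Ω v + (1 + C) * normL2 v ^ 2 := fun v hv =>
    (mul_nonneg (by linarith [hS.theta_lt_one]) (sq_nonneg _)).trans (hS.coercive hV0 hv)
  rw [shiftedQuad, sub_nonneg]
  -- functions vanishing almost everywhere are excluded from the Rayleigh quotient
  by_cases h0 : normL2 u = 0
  · have := coer u hu
    rw [h0] at this ⊢
    simpa using this
  have pos : ∀ v : Rd d → ℂ, normL2 v ≠ 0 → 0 < normL2 v ^ 2 := fun v hv => by positivity
  have hb : BddBelow {r : ℝ | ∃ u ∈ X V, ¬ u =ᵐ[volume] 0 ∧ r = quadR V Ω u / normL2 u ^ 2} := by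
    refine ⟨-(1 + C), ?_⟩
    rintro _ ⟨v, hv, hv0, rfl⟩
    rw [le_div_iff₀ (pos v fun h => hv0 (ae_eq_zero_of_normL2_eq_zero hv.1.1 h))]
    linarith [coer v hv]
  rw [← le_div_iff₀ (pos u h0)]
  refine csInf_le hb ⟨u, hu, fun h => h0 ?_, rfl⟩
  rw [normL2_congr h]
  simp [normL2]

/-- A consequence of the parallelogram law and of nonnegativity. -/
theorem shiftedQuad_sub_le (hS : SubcriticalRotation V Ω θ C) (hV : Measurable V)
    (hV0 : ∀ x, 0 ≤ V x) {u v : Rd d → ℂ} (hu : u ∈ X V) (hv : v ∈ X V) :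
    shiftedQuad V Ω (u - v) ≤ 2 * (shiftedQuad V Ω u + shiftedQuad V Ω v) := by
  have hv' := X_smul hV hV0 hv (-1)
  have h1 := shiftedQuad_add hS hV hV0 hu hv
  have h2 := shiftedQuad_add hS hV hV0 hu hv'
  have h3 := shiftedQuad_nonneg hS hV0 (X_add hV hV0 hu hv)
  rw [shiftedQuad_smul hS hV hV0 hv, ← shiftedForm_conj hS hV0 hv' hu,
    shiftedForm_smul_left hv, neg_one_mul, map_neg, shiftedForm_conj hS hV0 hv hu,
    Complex.neg_re, neg_one_smul, ← sub_eq_add_neg, norm_neg, norm_one] at h2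
  linarith

/-- A zero of the nonnegative shifted form is an eigenfunction at the lowest eigenvalue. -/
theorem mem_E0_of_shiftedQuad_eq_zero (hS : SubcriticalRotation V Ω θ C) (hV : Measurable V)
    (hV0 : ∀ x, 0 ≤ V x) {u : Rd d → ℂ} (hu : u ∈ X V) (h : shiftedQuad V Ω u = 0) :
    u ∈ E0 V Ω := by
  have re0 : ∀ v ∈ X V, (shiftedForm V Ω v u).re = 0 := fun v hv => by
    -- the quadratic polynomial `t ↦ Q(t v + u)` is nonnegative and has no constant term
    have hq : ∀ t : ℝ, 0 ≤ shiftedQuad V Ω v * (t * t) + 2 * (shiftedForm V Ω v u).re * t + 0 :=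
      fun t => by
        have hv' := X_smul hV hV0 hv (t : ℂ)
        have h1 := shiftedQuad_nonneg hS hV0 (X_add hV hV0 hv' hu)
        rw [shiftedQuad_add hS hV hV0 hv' hu, h, shiftedQuad_smul hS hV hV0 hv,
          shiftedForm_smul_left hv, Complex.re_ofReal_mul, Complex.norm_real, Real.norm_eq_abs,
          sq_abs] at h1
        linarith
    have := discrim_le_zero hq
    rw [discrim] at this
    nlinarith
  refine ⟨hu, hu.1.1.const_mul _, fun v hv => ?_⟩
  have zero : shiftedForm V Ω v u = 0 := by
    refine Complex.ext (re0 v hv) ?_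
    -- replacing `v` by `-i v` turns the imaginary part into the real part
    have := re0 _ (X_smul hV hV0 hv (-Complex.I))
    rw [shiftedForm_smul_left hv] at this
    simpa using this
  have zero' : shiftedForm V Ω u v = 0 := by
    rw [← shiftedForm_conj hS hV0 hv hu, zero, map_zero]
  rw [shiftedForm, sub_eq_zero, ← integral_const_mul] at zero'
  simpa only [mul_assoc] using zero'

/-! ### Near-minimizers of the Rayleigh quotient -/

theorem distE0_le {u v : Rd d → ℂ} (hv : v ∈ E0 V Ω) : distE0 V Ω u ≤ normX V (u - v) :=
  csInf_le ⟨0, by rintro _ ⟨w, -, rfl⟩; exact normX_nonneg _ _⟩ ⟨v, hv, rfl⟩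

/-- Near-minimizers of the Rayleigh quotient are close to the lowest eigenspace in the norm of
the energy space. -/
theorem exists_distE0_lt_of_near_minimizer (hS : SubcriticalRotation V Ω θ C)
    (hV : Measurable V) (hV0 : ∀ x, 0 ≤ V x) (hVconf : Tendsto V (cocompact (Rd d)) atTop)
    {ε : ℝ} (hε : 0 < ε) :
    ∃ δ > 0, ∀ u ∈ X V, normL2 u = 1 → quadR V Ω u < lambda0 V Ω + δ → distE0 V Ω u < ε := by
  by_contra! hcon
  choose u hu hnorm hquad hdist using fun n : ℕ =>
    hcon (1 / ((n : ℝ) + 1)) (by positivity)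
  set a : ℝ := (1 - θ) / 2 with ha_def
  have ha : 0 < a := by rw [ha_def]; linarith [hS.theta_lt_one]
  have hC := hS.const_nonneg
  set L : ℝ := |lambda0 V Ω| + (1 + C) with hL
  have hL0 : 0 < L := by rw [hL]; positivity
  have hl := le_abs_self (lambda0 V Ω)
  have hl' := neg_abs_le (lambda0 V Ω)
  have coer : ∀ v ∈ X V, a * normX V v ^ 2 ≤ shiftedQuad V Ω v + L * normL2 v ^ 2 :=
    fun v hv => by
      have h1 := hS.coercive hV0 hv
      rw [shiftedQuad, hL]
      nlinarith [sq_nonneg (normL2 v)]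
  have upper : ∀ v ∈ X V, shiftedQuad V Ω v ≤ (2 + C + |lambda0 V Ω|) * normX V v ^ 2 :=
    fun v hv => by
      have h1 := hS.quadR_le hV0 hv
      have h2 := pow_le_pow_left₀ (normL2_nonneg _) (normL2_le_normX hV0 hv) 2
      have h3 := mul_le_mul_of_nonneg_left h2 (abs_nonneg (lambda0 V Ω))
      rw [shiftedQuad]
      nlinarith [sq_nonneg (normL2 v)]
  have hQ : ∀ n, shiftedQuad V Ω (u n) < 1 / ((n : ℝ) + 1) := fun n => by
    have := hquad n
    rw [shiftedQuad, hnorm n]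
    linarith
  have hQ1 : ∀ n, shiftedQuad V Ω (u n) ≤ 1 := fun n => (hQ n).le.trans
    ((div_le_one (by positivity)).mpr (by linarith [Nat.cast_nonneg (α := ℝ) n]))
  have hM : ∀ n, normX V (u n) ≤ √((1 + L) / a) := fun n => by
    refine Real.le_sqrt_of_sq_le ?_
    rw [le_div_iff₀ ha]
    have := coer _ (hu n)
    rw [hnorm n] at this
    linarith [hQ1 n]
  obtain ⟨φ, hφ, hcau⟩ := exists_cauchy_subseq_normL2 hV hV0 hVconf hu hM
  have hQφ : Tendsto (fun n => shiftedQuad V Ω (u (φ n))) atTop (𝓝 0) :=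
    squeeze_zero (fun n => shiftedQuad_nonneg hS hV0 (hu _)) (fun n => (hQ _).le)
      (tendsto_one_div_add_atTop_nhds_zero_nat.comp hφ.tendsto_atTop)
  -- by the parallelogram law and coercivity the subsequence is Cauchy in the energy norm
  have hX : ∀ η > 0, ∃ N, ∀ n ≥ N, ∀ m ≥ N, normX V (u (φ n) - u (φ m)) < η := fun η hη => by
    obtain ⟨N1, hN1⟩ := eventually_atTop.mp
      (hQφ.eventually_lt_const (show 0 < a * η ^ 2 / 8 by positivity))
    obtain ⟨N2, hN2⟩ := hcau (√(a * η ^ 2 / (2 * L))) (by positivity)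
    refine ⟨max N1 N2, fun n hn m hm => ?_⟩
    have hw := X_sub hV hV0 (hu (φ n)) (hu (φ m))
    have h1 := coer _ hw
    have h2 := shiftedQuad_sub_le hS hV hV0 (hu (φ n)) (hu (φ m))
    have h3 := hN1 n ((le_max_left _ _).trans hn)
    have h4 := hN1 m ((le_max_left _ _).trans hm)
    have h5 := hN2 n ((le_max_right _ _).trans hn) m ((le_max_right _ _).trans hm)
    rw [Real.lt_sqrt (normL2_nonneg _), lt_div_iff₀ (by positivity)] at h5
    refine lt_of_pow_lt_pow_left₀ 2 hη.le (lt_of_mul_lt_mul_left ?_ ha.le)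
    linarith
  obtain ⟨v, hv, hlim⟩ := exists_tendsto_normX hV hV0 (fun n => hu (φ n)) hX
  have hv0 : shiftedQuad V Ω v = 0 := by
    refine le_antisymm ?_ (shiftedQuad_nonneg hS hV0 hv)
    have lim := (hQφ.add ((hlim.pow 2).const_mul (2 + C + |lambda0 V Ω|))).const_mul 2
    rw [zero_pow two_ne_zero, mul_zero, add_zero, mul_zero] at lim
    refine ge_of_tendsto' lim fun n => ?_
    have hw := X_sub hV hV0 (hu (φ n)) hv
    have h1 := shiftedQuad_sub_le hS hV hV0 (hu (φ n)) hw
    rw [sub_sub_cancel] at h1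
    linarith [upper _ hw]
  have hE := mem_E0_of_shiftedQuad_eq_zero hS hV hV0 hv hv0
  obtain ⟨n, hn⟩ := (hlim.eventually_lt_const hε).exists
  exact absurd ((distE0_le hE).trans_lt hn) (not_lt.mpr (hdist (φ n)))

theorem distE0_zero_le (hS : SubcriticalRotation V Ω θ C) (hV : Measurable V)
    (hV0 : ∀ x, 0 ≤ V x) : distE0 V Ω 0 ≤ 0 := by
  have hq : shiftedQuad V Ω 0 = 0 := by
    have := shiftedQuad_smul hS hV hV0 (X_zero (V := V)) 0
    simpa using this
  have h0 : normL2 (0 : Rd d → ℂ) = 0 := by simp [normL2]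
  refine (distE0_le (mem_E0_of_shiftedQuad_eq_zero hS hV hV0 X_zero hq)).trans ?_
  have h1 := hS.coercive hV0 (X_zero (V := V))
  rw [shiftedQuad, h0] at hq
  rw [h0] at h1
  have h2 : (1 - θ) / 2 * normX V (0 : Rd d → ℂ) ^ 2 ≤ (1 - θ) / 2 * 0 := by linarith
  have h3 := le_of_mul_le_mul_left h2 (by linarith [hS.theta_lt_one])
  rw [sub_zero]
  exact (sq_eq_zero_iff.mp (le_antisymm h3 (sq_nonneg _))).le

/-- Functions at which the linear part of the action is nonpositive have their normalizations
close to the lowest eigenspace, for `ω` slightly below `-λ₀(Ω)`. -/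
theorem eventually_distE0_normalize_lt (hS : SubcriticalRotation V Ω θ C)
    (hV : Measurable V) (hV0 : ∀ x, 0 ≤ V x) (hVconf : Tendsto V (cocompact (Rd d)) atTop)
    {ε : ℝ} (hε : 0 < ε) :
    ∀ᶠ ω in 𝓝[<] (-lambda0 V Ω), ∀ φ ∈ X V, quadR V Ω φ + ω * normL2 φ ^ 2 ≤ 0 →
      distE0 V Ω (normalize φ) < ε := by
  obtain ⟨δ, hδ, hmain⟩ := exists_distE0_lt_of_near_minimizer hS hV hV0 hVconf hε
  filter_upwards [Ioo_mem_nhdsLT (show -lambda0 V Ω - δ < -lambda0 V Ω by linarith)]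
    with ω hω φ hφ hle
  -- for `φ = 0` almost everywhere the division by zero makes `normalize φ` the zero function, which
  -- is in `E₀`
  by_cases h0 : normL2 φ = 0
  · have : normalize φ = 0 := by funext x; simp [normalize, h0]
    rw [this]
    exact (distE0_zero_le hS hV hV0).trans_lt hε
  have pos : 0 < normL2 φ := lt_of_le_of_ne (normL2_nonneg _) (Ne.symm h0)
  set c : ℂ := (((normL2 φ)⁻¹ : ℝ) : ℂ) with hc
  have hcn : ‖c‖ = (normL2 φ)⁻¹ := by
    rw [hc, Complex.norm_real, Real.norm_of_nonneg (by positivity)]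
  have hn : normalize φ = c • φ := by
    funext x
    rw [normalize, Pi.smul_apply, smul_eq_mul, hc, Complex.ofReal_inv, div_eq_inv_mul]
  have h1 : normL2 (c • φ) = 1 := by rw [normL2_smul, hcn, inv_mul_cancel₀ h0]
  rw [hn]
  refine hmain _ (X_smul hV hV0 hφ c) h1 ?_
  have h2 := shiftedQuad_smul hS hV hV0 hφ c
  have h3 : shiftedQuad V Ω φ ≤ (-ω - lambda0 V Ω) * normL2 φ ^ 2 := by
    rw [shiftedQuad]; linarith
  have h4 : shiftedQuad V Ω (c • φ) ≤ -ω - lambda0 V Ω := by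
    rw [h2, hcn, inv_pow, inv_mul_le_iff₀ (by positivity)]
    linarith
  rw [shiftedQuad, h1] at h4
  linarith [hω.1]

/-! ### Action ground states -/

/-- Testing the stationary equation with the solution itself. -/
theorem IsStationary.quadR_add_le {p ω : ℝ} {φ : Rd d → ℂ} (h : IsStationary p V Ω ω φ) :
    quadR V Ω φ + ω * normL2 φ ^ 2 ≤ 0 := by
  have h1 := h.2.2 φ h.1
  have e : ∫ x, ((‖φ x‖ ^ (p - 1) : ℝ) : ℂ) * φ x * conj (φ x)
      = ((∫ x, ‖φ x‖ ^ (p - 1) * ‖φ x‖ ^ 2 : ℝ) : ℂ) := by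
    rw [← integral_complex_ofReal]
    refine integral_congr_ae (Eventually.of_forall fun x => ?_)
    simp only [mul_assoc, Complex.mul_conj, Complex.normSq_eq_norm_sq, Complex.ofReal_mul]
  have h2 : 0 ≤ ∫ x, ‖φ x‖ ^ (p - 1) * ‖φ x‖ ^ 2 :=
    integral_nonneg fun x => mul_nonneg (Real.rpow_nonneg (norm_nonneg _) _) (sq_nonneg _)
  rw [e, integral_mul_conj_self] at h1
  have h3 := congrArg Complex.re h1
  rw [Complex.add_re, Complex.add_re, formR_self_re, Complex.ofReal_re, ← Complex.ofReal_mul,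
    Complex.ofReal_re, Complex.zero_re] at h3
  linarith

theorem action_eq (p : ℝ) (ω : ℝ) (φ : Rd d → ℂ) : action p V Ω ω φ
    = quadR V Ω φ + ω * normL2 φ ^ 2 + 2 / (p + 1) * ∫ x, ‖φ x‖ ^ (p + 1) := by
  rw [action, quadR, normL2_sq]
  ring

/-- Comparing a minimizer of the action with the zero function. -/
theorem quadR_add_le_of_mem_actionMinimizers (hS : SubcriticalRotation V Ω θ C)
    (hV : Measurable V) (hV0 : ∀ x, 0 ≤ V x) {p ω : ℝ} (hp : 1 < p) {φ : Rd d → ℂ}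
    (h : φ ∈ actionMinimizers p V Ω ω) : quadR V Ω φ + ω * normL2 φ ^ 2 ≤ 0 := by
  have h1 := h.2 0 X_zero
  have hn : normL2 (0 : Rd d → ℂ) = 0 := by simp [normL2]
  have hq : shiftedQuad V Ω 0 = 0 := by
    have := shiftedQuad_smul hS hV hV0 (X_zero (V := V)) 0
    simpa using this
  have h2 : 0 ≤ 2 / (p + 1) * ∫ x, ‖φ x‖ ^ (p + 1) :=
    mul_nonneg (div_nonneg two_pos.le (by linarith))
      (integral_nonneg fun x => Real.rpow_nonneg (norm_nonneg _) _)
  have h3 : ∫ x : Rd d, ‖(0 : Rd d → ℂ) x‖ ^ (p + 1) = 0 := by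
    have : p + 1 ≠ 0 := by linarith
    simp [Real.zero_rpow this]
  rw [shiftedQuad, hn] at hq
  rw [action_eq, action_eq, hn, h3] at h1
  linarith

end

end RotNLS

end

theorem proposition4p12 (d : ℕ) (hd : 1 ≤ d) (p : ℝ) (hp : 1 < p)
    (hpd : 3 ≤ d → p < ((d : ℝ) + 2) / ((d : ℝ) - 2))
    (V : RotNLS.Rd d → ℝ) (hVmeas : Measurable V) (hVnonneg : ∀ x, 0 ≤ V x)
    (hVconf : Tendsto V (cocompact (RotNLS.Rd d)) atTop)
    (Ω : ℝ) (hΩ : Ω = 0 ∨ ((|Ω| : ℝ) : EReal) < RotNLS.OmegaMax V) :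
    (∀ ε : ℝ, 0 < ε → ∀ᶠ ω in 𝓝[<] (-RotNLS.lambda0 V Ω),
      ∀ φ ∈ RotNLS.actionGroundStates p V Ω ω,
        RotNLS.distE0 V Ω (RotNLS.normalize φ) < ε) ∧
    (∀ ε : ℝ, 0 < ε → ∀ᶠ ω in 𝓝[<] (-RotNLS.lambda0 V Ω),
      ∀ φ ∈ RotNLS.actionMinimizers p V Ω ω,
        RotNLS.distE0 V Ω (RotNLS.normalize φ) < ε) := by
  obtain ⟨θ, C, hS⟩ := RotNLS.exists_subcriticalRotation hVnonneg hΩ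
  constructor
  · intro ε hε
    filter_upwards [RotNLS.eventually_distE0_normalize_lt hS hVmeas hVnonneg hVconf hε]
      with ω hω φ hφ
    exact hω φ hφ.1.1 hφ.1.quadR_add_le
  · intro ε hε
    filter_upwards [RotNLS.eventually_distE0_normalize_lt hS hVmeas hVnonneg hVconf hε]
      with ω hω φ hφ
    exact hω φ hφ.1
      (RotNLS.quadR_add_le_of_mem_actionMinimizers hS hVmeas hVnonneg hp hφ)
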